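/- Let $N\ge 3$ be an integer, $0<\lambda\le\Lambda$, $p>1$, $a>-1$ and $0<\mathfrak a<\mathfrak b<\infty$. For a real symmetric $N\times N$ matrix $X$ let $$\mathcal M^+(X)=\sup_{\lambda I\le A\le\Lambda I}\operatorname{tr}(AX),\qquad \mathcal M^-(X)=\inf_{\lambda I\le A\le\Lambda I}\operatorname{tr}(AX)$$ be Pucci's extremal operators ($A$ ranging over real symmetric $N\times N$ matrices), let $\tilde N_+=\frac{\lambda}{\Lambda}(N-1)+1$, and let $\Omega=\{x\in\mathbb R^N:\mathfrak a<|x|<\mathfrak b\}$. Solutions are classical: $C^2$ in $\Omega$ and continuous on $\overline\Omega$. (1) If $\mathcal M=\mathcal M^-$, or if $\mathcal M=\mathcal M^+$ and $\tilde N_+>2$, then the problem $$\mathcal M(D^2u)+|x|^a u^p=0\ \text{ in }\Omega,\qquad u>0\ \text{ in }\Omega,\qquad u=0\ \text{ on }\partial\Omega$$ has a radial solution. (2) If $\mathcal M=\mathcal M^+$, or if $\mathcal M=\mathcal M^-$ and $\tilde N_+>2$, then the problem $$\mathcal M(D^2v)+|x|^a|v|^{p-1}v=0\ \text{ in }\Omega,\qquad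 v<0\ \text{ in }\Omega,\qquad v=0\ \text{ on }\partial\Omega$$ has a radial solution. -/

import Mathlib

noncomputable section

namespace HenonPucci

/-- The real symmetric matrices `A` with `l I ≤ A ≤ L I`. -/
def ellipticMatrices (N : ℕ) (l L : ℝ) : Set (Matrix (Fin N) (Fin N) ℝ) :=
  {A | A.IsSymm ∧ (A - l • (1 : Matrix (Fin N) (Fin N) ℝ)).PosSemidef ∧
    (L • (1 : Matrix (Fin N) (Fin N) ℝ) - A).PosSemidef}

/-- The set of values `tr (A X)`, where `A` is symmetric with `l I ≤ A ≤ L I`. -/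
def pucciValues {N : ℕ} (l L : ℝ) (X : Matrix (Fin N) (Fin N) ℝ) : Set ℝ :=
  (fun A : Matrix (Fin N) (Fin N) ℝ => (A * X).trace) '' ellipticMatrices N l L

/-- Pucci's maximal operator `M⁺(X) = sup { tr (A X) : l I ≤ A ≤ L I }`. -/
def pucciPlus {N : ℕ} (l L : ℝ) (X : Matrix (Fin N) (Fin N) ℝ) : ℝ :=
  sSup (pucciValues l L X)

/-- Pucci's minimal operator `M⁻(X) = inf { tr (A X) : l I ≤ A ≤ L I }`. -/
def pucciMinus {N : ℕ} (l L : ℝ) (X : Matrix (Fin N) (Fin N) ℝ) : ℝ :=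
  sInf (pucciValues l L X)

/-- For `l ≤ L` the supremum and the infimum above are taken over a nonempty set. -/
theorem pucciValues_nonempty {N : ℕ} {l L : ℝ} (h : l ≤ L) (X : Matrix (Fin N) (Fin N) ℝ) :
    (pucciValues l L X).Nonempty := by
  refine ⟨_, l • (1 : Matrix (Fin N) (Fin N) ℝ), ⟨?_, ?_, ?_⟩, rfl⟩
  · simp [Matrix.IsSymm, Matrix.transpose_smul]
  · rw [sub_self]
    exact Matrix.PosSemidef.zero
  · rw [← sub_smul]
    exact Matrix.PosSemidef.one.smul (sub_nonneg.2 h)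

/-- The entries of the admissible matrices are bounded. -/
theorem abs_entry_le {N : ℕ} {l L : ℝ} (hl : 0 < l) {A : Matrix (Fin N) (Fin N) ℝ}
    (hA : A ∈ ellipticMatrices N l L) (i j : Fin N) : |A i j| ≤ L := by
  obtain ⟨hs, h1, h2⟩ := hA
  have hP : A.PosSemidef := by
    have h3 := h1.add ((Matrix.PosSemidef.one (n := Fin N) (R := ℝ)).smul hl.le)
    simpa using h3
  have hd : ∀ k, A k k ≤ L := fun k => by
    have h4 := h2.diag_nonneg (i := k)
    simpa using h4
  have hsij : A j i = A i j := hs.apply i j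
  have q1 := hP.dotProduct_mulVec_nonneg (Pi.single i 1 + Pi.single j 1)
  have q2 := hP.dotProduct_mulVec_nonneg (Pi.single i 1 - Pi.single j 1)
  simp [Matrix.mulVec_add, Matrix.mulVec_sub, add_dotProduct, sub_dotProduct] at q1 q2
  rw [abs_le]
  constructor <;> linarith [hd i, hd j]

/-- For `0 < l` the values `tr (A X)` are bounded, so `pucciPlus` and `pucciMinus` are a genuine
supremum and a genuine infimum. -/
theorem pucciValues_abs_le {N : ℕ} {l L : ℝ} (hl : 0 < l) (X : Matrix (Fin N) (Fin N) ℝ) :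
    ∀ t ∈ pucciValues l L X, |t| ≤ ∑ i, ∑ j, L * |X j i| := by
  rintro t ⟨A, hA, rfl⟩
  simp only [Matrix.trace, Matrix.diag, Matrix.mul_apply]
  refine (Finset.abs_sum_le_sum_abs _ _).trans (Finset.sum_le_sum fun i _ => ?_)
  refine (Finset.abs_sum_le_sum_abs _ _).trans (Finset.sum_le_sum fun j _ => ?_)
  rw [abs_mul]
  exact mul_le_mul_of_nonneg_right (abs_entry_le hl hA i j) (abs_nonneg _)

/-- The Hessian matrix `D²u(x)` of second partial derivatives. -/
def hessian {N : ℕ} (u : EuclideanSpace ℝ (Fin N) → ℝ) (x : EuclideanSpace ℝ (Fin N)) :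
    Matrix (Fin N) (Fin N) ℝ :=
  Matrix.of fun i j =>
    fderiv ℝ (fderiv ℝ u) x (EuclideanSpace.single i 1) (EuclideanSpace.single j 1)

/-- The open annulus `{x ∈ ℝᴺ : r₁ < |x| < r₂}`. -/
def annulus (N : ℕ) (r₁ r₂ : ℝ) : Set (EuclideanSpace ℝ (Fin N)) :=
  {x | r₁ < ‖x‖ ∧ ‖x‖ < r₂}

/-- The dimension-like number `Ñ₊ = (l / L) (N - 1) + 1`. -/
def dimPlus (N : ℕ) (l L : ℝ) : ℝ := l / L * ((N : ℝ) - 1) + 1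

/-- `u` is radial on `S`: its value at `x ∈ S` depends on `|x|` only. -/
def IsRadialOn {N : ℕ} (u : EuclideanSpace ℝ (Fin N) → ℝ)
    (S : Set (EuclideanSpace ℝ (Fin N))) : Prop :=
  ∃ w : ℝ → ℝ, ∀ x ∈ S, u x = w ‖x‖

/-- `u` is a positive classical solution of `F(D²u) + |x|^a u^p = 0` in `Ω`, with `u = 0`
on `∂Ω`: it is `C²` in `Ω` and continuous up to the boundary. -/
structure IsPositiveSolution {N : ℕ} (F : Matrix (Fin N) (Fin N) ℝ → ℝ) (a p : ℝ)
    (Ω : Set (EuclideanSpace ℝ (Fin N))) (u : EuclideanSpace ℝ (Fin N) → ℝ) : Prop where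
  contDiffOn : ContDiffOn ℝ 2 u Ω
  continuousOn : ContinuousOn u (closure Ω)
  equation : ∀ x ∈ Ω, F (hessian u x) + ‖x‖ ^ a * u x ^ p = 0
  pos : ∀ x ∈ Ω, 0 < u x
  boundary : ∀ x ∈ frontier Ω, u x = 0

/-- `v` is a negative classical solution of `F(D²v) + |x|^a |v|^(p-1) v = 0` in `Ω`, with `v = 0`
on `∂Ω`: it is `C²` in `Ω` and continuous up to the boundary. -/
structure IsNegativeSolution {N : ℕ} (F : Matrix (Fin N) (Fin N) ℝ → ℝ) (a p : ℝ)
    (Ω : Set (EuclideanSpace ℝ (Fin N))) (v : EuclideanSpace ℝ (Fin N) → ℝ) : Prop where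
  contDiffOn : ContDiffOn ℝ 2 v Ω
  continuousOn : ContinuousOn v (closure Ω)
  equation : ∀ x ∈ Ω, F (hessian v x) + ‖x‖ ^ a * (|v x| ^ (p - 1) * v x) = 0
  neg : ∀ x ∈ Ω, v x < 0
  boundary : ∀ x ∈ frontier Ω, v x = 0

end HenonPucci

end

open Set Filter Topology
open scoped NNReal

namespace HenonPucci

/-! ### Differential inequalities -/

/-! The Hessian of a radial function `w(|x|)` has eigenvalue `w''` on the line through `x` and
`w'/r` on its orthogonal complement. At such matrices both Pucci operators act eigenvalue by
eigenvalue through a piecewise linear increasing function `P` (`pucciWeight`). The problem becomes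
`P(w'') + (N-1) P(w'/r) + r^a w^p = 0` with zero data at both radii, and since `P` is invertible it
can be solved for `w''`. Negative solutions are the negatives of positive solutions for the dual
operator.

This two-point problem is solved by shooting. Since `P` is positively homogeneous of degree one and
the power is not, varying the initial slope is equivalent to fixing the slope at 1 and putting a
factor `μ` before the power; afterwards `w = μ^(1/(p-1)) z` removes the factor. With slope 1 the
derivative stays at most 1, so `z ≤ b - a`, and truncating the power at that height changes nothing
on nonnegative solutions while making the field globally Lipschitz.

For `μ = 0` the solution never turns back and is positive after `a`. For one large `μ` it must reach
zero, by a Prüfer angle argument (`IsShootingSolution.false_of_large`, `exists_solution_nonpos`).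
The minimum of `z` away from `a` depends continuously on `μ` (`exists_dist_le_mul`), so it vanishes
for some `μ`. A zero minimum inside the interval would be a double zero, excluded by uniqueness;
hence it lies at `b` (`exists_solution_dirichlet`). -/

theorem image_le_of_hasDerivWithinAt_Icc {f f' B B' : ℝ → ℝ} {a b s r : ℝ}
    (h : ∀ t ∈ Icc a b, HasDerivWithinAt f (f' t) (Icc a b) t) (hs : a ≤ s) (hr : r ≤ b)
    (h0 : f s ≤ B s) (hB : ∀ t, HasDerivAt B (B' t) t)
    (bound : ∀ t ∈ Ico s r, f t = B t → f' t < B' t) : ∀ t ∈ Icc s r, f t ≤ B t := by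
  have hsub : Icc s r ⊆ Icc a b := Icc_subset_Icc hs hr
  intro t ht
  refine image_le_of_deriv_right_lt_deriv_boundary (f' := f')
    (fun x hx => ((h x (hsub hx)).continuousWithinAt).mono hsub) (fun x hx => ?_) h0 hB bound ht
  exact (h x (hsub (Ico_subset_Icc_self hx))).mono_of_mem_nhdsWithin
    (Icc_mem_nhdsGE_of_mem ⟨hs.trans hx.1, hx.2.trans_le hr⟩)

theorem image_le_add_mul_of_deriv_le {f f' : ℝ → ℝ} {a b s r K : ℝ}
    (h : ∀ t ∈ Icc a b, HasDerivWithinAt f (f' t) (Icc a b) t) (hs : a ≤ s) (hr : r ≤ b)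
    (bound : ∀ t ∈ Ico s r, f' t ≤ K) : ∀ t ∈ Icc s r, f t ≤ f s + K * (t - s) := by
  have hsub : Icc s r ⊆ Icc a b := Icc_subset_Icc hs hr
  intro t ht
  have hB : ∀ x : ℝ, HasDerivAt (fun x => f s + K * (x - s)) K x := fun x => by
    simpa using (((hasDerivAt_id x).sub_const s).const_mul K).const_add (f s)
  refine image_le_of_deriv_right_le_deriv_boundary (f' := f') (B' := fun _ => K)
    (B := fun x => f s + K * (x - s))
    (fun x hx => ((h x (hsub hx)).continuousWithinAt).mono hsub) (fun x hx => ?_) (by simp)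
    (fun x _ => (hB x).continuousAt.continuousWithinAt)
    (fun x _ => (hB x).hasDerivWithinAt) bound ht
  exact (h x (hsub (Ico_subset_Icc_self hx))).mono_of_mem_nhdsWithin
    (Icc_mem_nhdsGE_of_mem ⟨hs.trans hx.1, hx.2.trans_le hr⟩)

theorem image_ge_add_mul_of_le_deriv {f f' : ℝ → ℝ} {a b s r K : ℝ}
    (h : ∀ t ∈ Icc a b, HasDerivWithinAt f (f' t) (Icc a b) t) (hs : a ≤ s) (hr : r ≤ b)
    (bound : ∀ t ∈ Ico s r, K ≤ f' t) : ∀ t ∈ Icc s r, f s + K * (t - s) ≤ f t := by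
  intro t ht
  have := image_le_add_mul_of_deriv_le (f := fun t => -f t) (f' := fun t => -f' t) (K := -K)
    (fun t ht => (h t ht).neg) hs hr (fun t ht => neg_le_neg (bound t ht)) t ht
  linarith

/-! ### Global existence for globally Lipschitz planar systems -/

/-- Coordinatewise truncation to `[-Q, Q]²`. -/
def truncate (Q : ℝ) (x : ℝ × ℝ) : ℝ × ℝ := (max (-Q) (min x.1 Q), max (-Q) (min x.2 Q))

theorem lipschitzWith_truncate (Q : ℝ) : LipschitzWith 1 (truncate Q) := by
  have h1 : LipschitzWith 1 fun x : ℝ × ℝ => max (-Q) (min x.1 Q) :=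
    (LipschitzWith.prod_fst.min_const Q).const_max (-Q)
  have h2 : LipschitzWith 1 fun x : ℝ × ℝ => max (-Q) (min x.2 Q) :=
    (LipschitzWith.prod_snd.min_const Q).const_max (-Q)
  have h := h1.prodMk h2
  rwa [max_self] at h

theorem truncate_zero {Q : ℝ} (hQ : 0 ≤ Q) : truncate Q 0 = 0 := by
  simp [truncate, hQ]

theorem norm_truncate_le_norm {Q : ℝ} (hQ : 0 ≤ Q) (x : ℝ × ℝ) : ‖truncate Q x‖ ≤ ‖x‖ := by
  simpa [truncate_zero hQ] using (lipschitzWith_truncate Q).dist_le_mul x 0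

theorem norm_truncate_le {Q : ℝ} (hQ : 0 ≤ Q) (x : ℝ × ℝ) : ‖truncate Q x‖ ≤ Q := by
  have h : ∀ y : ℝ, |max (-Q) (min y Q)| ≤ Q := fun y =>
    abs_le.2 ⟨le_max_left _ _, max_le (by linarith) (min_le_right _ _)⟩
  exact max_le (h _) (h _)

theorem truncate_eq_self {Q : ℝ} {x : ℝ × ℝ} (h : ‖x‖ ≤ Q) : truncate Q x = x := by
  have h1 := abs_le.1 ((norm_fst_le x).trans h)
  have h2 := abs_le.1 ((norm_snd_le x).trans h)
  simp [truncate, min_eq_left h1.2, min_eq_left h2.2, max_eq_right h1.1, max_eq_right h2.1]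

/-- Composing with the truncation makes the field bounded, so Picard–Lindelöf covers all of `[a, b]`
at once. Truncation does not increase norms, so linear growth survives, and Grönwall keeps the
solution in the box of size `Q`, where the truncation is inactive. -/
theorem exists_forall_hasDerivWithinAt_of_lipschitzWith {F : ℝ → ℝ × ℝ → ℝ × ℝ} {K : ℝ≥0}
    (hK : ∀ t, LipschitzWith K (F t)) (hc : ∀ x, Continuous fun t => F t x)
    (h0 : ∀ t, F t 0 = 0) {a b : ℝ} (hab : a ≤ b) (x₀ : ℝ × ℝ) :
    ∃ X : ℝ → ℝ × ℝ, X a = x₀ ∧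
      ∀ t ∈ Icc a b, HasDerivWithinAt X (F t (X t)) (Icc a b) t := by
  set Q : ℝ := ‖x₀‖ * Real.exp (K * (b - a)) with hQdef
  have hQ : 0 ≤ Q := by positivity
  have hF : ∀ t x, ‖F t x‖ ≤ K * ‖x‖ := fun t x => by
    simpa [h0] using (hK t).dist_le_mul x 0
  have hlip : ∀ t, LipschitzWith K fun x => F t (truncate Q x) := fun t => by
    have h := (hK t).comp (lipschitzWith_truncate Q)
    rwa [mul_one] at h
  have hpl : IsPicardLindelof (fun t x => F t (truncate Q x))
      (⟨a, left_mem_Icc.2 hab⟩ : Icc a b) x₀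
      (K * Q.toNNReal * (b - a).toNNReal) 0 (K * Q.toNNReal) K := by
    refine ⟨fun t _ => (hlip t).lipschitzOnWith, fun x _ => (hc _).continuousOn,
      fun t _ x _ => ?_, ?_⟩
    · refine (hF _ _).trans ?_
      simp only [NNReal.coe_mul, Real.coe_toNNReal _ hQ]
      exact mul_le_mul_of_nonneg_left (norm_truncate_le hQ x) K.2
    · simp [Real.coe_toNNReal _ (sub_nonneg.2 hab), sub_nonneg.2 hab]
  obtain ⟨X, hXa, hX⟩ := hpl.exists_eq_forall_mem_Icc_hasDerivWithinAt₀
  refine ⟨X, hXa, fun t ht => ?_⟩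
  have hXb : ‖X t‖ ≤ Q := by
    have := norm_le_gronwallBound_of_norm_deriv_right_le (f := X)
      (f' := fun t => F t (truncate Q (X t))) (δ := ‖x₀‖) (K := K) (ε := 0) (a := a) (b := b)
      (fun t ht => (hX t ht).continuousWithinAt)
      (fun t ht => (hX t (Ico_subset_Icc_self ht)).mono_of_mem_nhdsWithin
        (Icc_mem_nhdsGE_of_mem ht)) (by rw [← hXa])
      (fun t _ => by
        simpa using (hF _ _).trans
          (mul_le_mul_of_nonneg_left (norm_truncate_le_norm hQ (X t)) K.2)) t ht
    rw [gronwallBound_ε0] at this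
    refine this.trans ?_
    rw [hQdef]
    have h3 : t - a ≤ b - a := by linarith [ht.2]
    gcongr
  have := hX t ht
  rwa [truncate_eq_self hXb] at this

/-! ### Shooting for superlinear equations -/

/-- The truncated power `min(z⁺, D)ᵖ`. -/
noncomputable def clampPow (D p z : ℝ) : ℝ := (max 0 (min z D)) ^ p

theorem clampPow_nonneg (D p z : ℝ) : 0 ≤ clampPow D p z :=
  Real.rpow_nonneg (le_max_left _ _) _

theorem clampPow_zero {D p : ℝ} (hD : 0 < D) (hp : 1 < p) : clampPow D p 0 = 0 := by
  simp [clampPow, hD.le, Real.zero_rpow (by linarith : p ≠ 0)]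

theorem clampPow_eq {D p z : ℝ} (h0 : 0 ≤ z) (hD : z ≤ D) : clampPow D p z = z ^ p := by
  simp [clampPow, h0, hD]

theorem clampPow_le {D p z t : ℝ} (hp : 1 < p) (ht : 0 ≤ t) (hz : z ≤ t) :
    clampPow D p z ≤ t ^ p :=
  Real.rpow_le_rpow (le_max_left _ _) (max_le ht ((min_le_left _ _).trans hz)) (by linarith)

/-- The structural conditions on the right-hand side of `z'' = G μ r z z'` which make shooting
in the parameter `μ` work. -/
structure IsShootingField (G : ℝ → ℝ → ℝ → ℝ → ℝ) (D p C c : ℝ) : Prop where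
  lipschitz : ∀ M : ℝ, ∃ K : ℝ≥0, ∀ μ ∈ Icc 0 M, ∀ r,
    LipschitzWith K fun x : ℝ × ℝ => (x.2, G μ r x.1 x.2)
  continuous : ∀ μ z q, Continuous fun r => G μ r z q
  upper : ∀ μ r z q, 0 ≤ μ → G μ r z q ≤ C * |q| - c * μ * clampPow D p z
  lower : ∀ μ r z q, 0 ≤ μ → -(C * |q|) - C * μ * clampPow D p z ≤ G μ r z q
  neg : ∀ μ r z q, 0 ≤ μ → 0 < q → G μ r z q < 0
  param : ∃ C' : ℝ≥0, ∀ μ ν r z q, |G μ r z q - G ν r z q| ≤ C' * |μ - ν|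

/-- `z` solves `z'' = G μ r z z'` on `[a, b]` with `z(a) = 0`, `z'(a) = 1`, and `q = z'`. -/
structure IsShootingSolution (G : ℝ → ℝ → ℝ → ℝ → ℝ) (μ a b : ℝ) (z q : ℝ → ℝ) : Prop where
  init : z a = 0
  init_deriv : q a = 1
  hasDeriv : ∀ t ∈ Icc a b, HasDerivWithinAt z (q t) (Icc a b) t
  hasDeriv_deriv : ∀ t ∈ Icc a b, HasDerivWithinAt q (G μ t (z t) (q t)) (Icc a b) t

namespace IsShootingField

variable {G : ℝ → ℝ → ℝ → ℝ → ℝ} {D p C c : ℝ}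

theorem apply_zero (hG : IsShootingField G D p C c) (hD : 0 < D) (hp : 1 < p) {μ : ℝ}
    (hμ : 0 ≤ μ) (r : ℝ) : G μ r 0 0 = 0 := by
  have h1 := hG.upper μ r 0 0 hμ
  have h2 := hG.lower μ r 0 0 hμ
  simp only [clampPow_zero hD hp, abs_zero, mul_zero, neg_zero, sub_zero] at h1 h2
  exact le_antisymm h1 h2

theorem apply_zero_param (hG : IsShootingField G D p C c) (r z : ℝ) : G 0 r z 0 = 0 := by
  have h1 := hG.upper 0 r z 0 le_rfl
  have h2 := hG.lower 0 r z 0 le_rfl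
  simp only [abs_zero, mul_zero, zero_mul, neg_zero, sub_zero] at h1 h2
  exact le_antisymm h1 h2

theorem exists_solution (hG : IsShootingField G D p C c) (hD : 0 < D) (hp : 1 < p) {μ a b : ℝ}
    (hμ : 0 ≤ μ) (hab : a ≤ b) : ∃ z q, IsShootingSolution G μ a b z q := by
  obtain ⟨K, hK⟩ := hG.lipschitz μ
  obtain ⟨X, hXa, hX⟩ := exists_forall_hasDerivWithinAt_of_lipschitzWith
    (F := fun r x => (x.2, G μ r x.1 x.2)) (hK μ ⟨hμ, le_rfl⟩)
    (fun x => continuous_const.prodMk (hG.continuous μ x.1 x.2))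
    (fun t => by simp [hG.apply_zero hD hp hμ]) hab (0, 1)
  refine ⟨fun t => (X t).1, fun t => (X t).2, by simp [hXa], by simp [hXa], fun t ht => ?_,
    fun t ht => ?_⟩
  · exact (hasFDerivAt_fst (𝕜 := ℝ) (p := X t)).comp_hasDerivWithinAt t (hX t ht)
  · exact (hasFDerivAt_snd (𝕜 := ℝ) (p := X t)).comp_hasDerivWithinAt t (hX t ht)

end IsShootingField

/-! ### A priori estimates along a shooting trajectory -/

namespace IsShootingSolution

variable {G : ℝ → ℝ → ℝ → ℝ → ℝ} {D p C c μ a b : ℝ} {z q : ℝ → ℝ}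

theorem hasDerivWithinAt_prodMk (h : IsShootingSolution G μ a b z q) {t : ℝ} (ht : t ∈ Icc a b) :
    HasDerivWithinAt (fun t => (z t, q t)) (q t, G μ t (z t) (q t)) (Icc a b) t :=
  (h.hasDeriv t ht).prodMk (h.hasDeriv_deriv t ht)

theorem deriv_le_one (h : IsShootingSolution G μ a b z q) (hG : IsShootingField G D p C c)
    (hμ : 0 ≤ μ) : ∀ t ∈ Icc a b, q t ≤ 1 :=
  image_le_of_hasDerivWithinAt_Icc (B := fun _ => 1) (B' := fun _ => 0) h.hasDeriv_deriv le_rfl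
    le_rfl h.init_deriv.le (fun t => hasDerivAt_const t 1)
    fun t _ hq => hG.neg _ _ _ _ hμ (by rw [hq]; exact one_pos)

theorem le_sub (h : IsShootingSolution G μ a b z q) (hG : IsShootingField G D p C c)
    (hμ : 0 ≤ μ) : ∀ t ∈ Icc a b, z t ≤ t - a := fun t ht => by
  simpa [h.init] using image_le_add_mul_of_deriv_le h.hasDeriv le_rfl le_rfl
    (fun s hs => h.deriv_le_one hG hμ s (Ico_subset_Icc_self hs)) t ht

/-- While `1/2 ≤ q ≤ 1` and `z ≤ τ`, the lower bound on `G` makes `q` fall at a rate below `A`, so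
it loses at most `A τ ≤ 1/2`. The summand 1 in `A` gives the strict inequality that the barrier
comparison needs. -/
theorem half_le_deriv (h : IsShootingSolution G μ a b z q) (hG : IsShootingField G D p C c)
    (hμ : 0 ≤ μ) (hC : 0 < C) (hp : 1 < p) {τ : ℝ} (hτ : 0 ≤ τ) (hτb : a + τ ≤ b)
    (hsmall : (C + 1 + C * μ * τ ^ p) * τ ≤ 1 / 2) : ∀ t ∈ Icc a (a + τ), 1 / 2 ≤ q t := by
  set A : ℝ := C + 1 + C * μ * τ ^ p with hA
  have hτp : 0 ≤ τ ^ p := Real.rpow_nonneg hτ p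
  have hA0 : 0 ≤ A := by positivity
  have key : ∀ t ∈ Icc a (a + τ), -q t ≤ -1 + A * (t - a) := by
    refine image_le_of_hasDerivWithinAt_Icc (f := fun t => -q t)
      (f' := fun t => -G μ t (z t) (q t)) (B := fun t => -1 + A * (t - a)) (B' := fun _ => A)
      (fun t ht => (h.hasDeriv_deriv t ht).neg) le_rfl hτb (by simp [h.init_deriv])
      (fun t => by simpa using (((hasDerivAt_id t).sub_const a).const_mul A).const_add (-1))
      fun t ht hq => ?_
    have ht' : t ∈ Icc a b := ⟨ht.1, ht.2.le.trans hτb⟩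
    have h1 : A * (t - a) ≤ 1 / 2 :=
      (mul_le_mul_of_nonneg_left (by linarith [ht.2] : t - a ≤ τ) hA0).trans hsmall
    have h2 : |q t| ≤ 1 := abs_le.2 ⟨by linarith, h.deriv_le_one hG hμ t ht'⟩
    have h3 := hG.lower μ t (z t) (q t) hμ
    have h4 : clampPow D p (z t) ≤ τ ^ p :=
      clampPow_le hp hτ ((h.le_sub hG hμ t ht').trans (by linarith [ht.2]))
    have h5 : C * μ * clampPow D p (z t) ≤ C * μ * τ ^ p := by gcongr
    have h6 : C * |q t| ≤ C * 1 := by gcongr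
    show -G μ t (z t) (q t) < A
    rw [hA]
    linarith
  intro t ht
  have h1 : A * (t - a) ≤ 1 / 2 :=
    (mul_le_mul_of_nonneg_left (by linarith [ht.2] : t - a ≤ τ) hA0).trans hsmall
  linarith [key t ht]

theorem half_mul_le (h : IsShootingSolution G μ a b z q) (hG : IsShootingField G D p C c)
    (hμ : 0 ≤ μ) (hC : 0 < C) (hp : 1 < p) {τ : ℝ} (hτ : 0 ≤ τ) (hτb : a + τ ≤ b)
    (hsmall : (C + 1 + C * μ * τ ^ p) * τ ≤ 1 / 2) :
    ∀ t ∈ Icc a (a + τ), 1 / 2 * (t - a) ≤ z t := fun t ht => by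
  simpa [h.init] using image_ge_add_mul_of_le_deriv h.hasDeriv le_rfl hτb
    (fun s hs => h.half_le_deriv hG hμ hC hp hτ hτb hsmall s (Ico_subset_Icc_self hs)) t ht

/-- Otherwise the constant `(z t, 0)` solves the same system through the same point, and backward
uniqueness contradicts `q a = 1`. This applies at zeros of `z`, and everywhere when `μ = 0`. -/
theorem deriv_ne_zero (h : IsShootingSolution G μ a b z q) (hG : IsShootingField G D p C c)
    (hμ : 0 ≤ μ) {t : ℝ} (ht : t ∈ Icc a b) (hz : ∀ s, G μ s (z t) 0 = 0) : q t ≠ 0 := by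
  intro hq
  obtain ⟨K, hK⟩ := hG.lipschitz μ
  have hEq : EqOn (fun s => (z s, q s)) (fun _ => (z t, (0 : ℝ))) (Icc a t) := by
    have hsub : Icc a t ⊆ Icc a b := Icc_subset_Icc_right ht.2
    refine ODE_solution_unique_of_mem_Icc_left
      (v := fun r (x : ℝ × ℝ) => (x.2, G μ r x.1 x.2)) (K := K) (s := fun _ => univ)
      (fun s _ => (hK μ ⟨hμ, le_rfl⟩ s).lipschitzOnWith)
      (fun s hs => ((h.hasDerivWithinAt_prodMk (hsub hs)).continuousWithinAt).mono hsub)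
      (fun s hs => (h.hasDerivWithinAt_prodMk (hsub (Ioc_subset_Icc_self hs))
        ).mono_of_mem_nhdsWithin (Icc_mem_nhdsLE_of_mem ⟨hs.1, hs.2.trans ht.2⟩))
      (fun _ _ => mem_univ _) continuousOn_const
      (fun s _ => ?_) (fun _ _ => mem_univ _) (by simp [hq])
    simp only [hz]
    exact hasDerivWithinAt_const s _ _
  have := congrArg Prod.snd (hEq ⟨le_rfl, ht.1⟩)
  simp [h.init_deriv] at this

/-- The forcing term only pushes `q` down, so a negative slope can relax towards zero at most
exponentially; the rate is `C + 1` rather than `C` for strictness. -/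
theorem deriv_le_of_neg (h : IsShootingSolution G μ a b z q) (hG : IsShootingField G D p C c)
    (hμ : 0 ≤ μ) (hc : 0 ≤ c) {s : ℝ} (hs : a ≤ s) (hq : q s < 0) :
    ∀ t ∈ Icc s b, q t ≤ q s * Real.exp (-(C + 1) * (t - s)) := by
  refine image_le_of_hasDerivWithinAt_Icc (B' := fun t =>
      q s * (Real.exp (-(C + 1) * (t - s)) * -(C + 1))) h.hasDeriv_deriv hs le_rfl (by simp)
    (fun t => ?_) fun t ht hqt => ?_
  · have : HasDerivAt (fun t => -(C + 1) * (t - s)) (-(C + 1)) t := by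
      simpa using ((hasDerivAt_id t).sub_const s).const_mul (-(C + 1))
    exact this.exp.const_mul _
  · have hE := Real.exp_pos (-(C + 1) * (t - s))
    have hneg : q t < 0 := by rw [hqt]; exact mul_neg_of_neg_of_pos hq hE
    have h1 := hG.upper μ t (z t) (q t) hμ
    have h2 : 0 ≤ c * μ * clampPow D p (z t) :=
      mul_nonneg (mul_nonneg hc hμ) (clampPow_nonneg _ _ _)
    have h3 : q s * (Real.exp (-(C + 1) * (t - s)) * -(C + 1)) = -(C + 1) * q t := by
      rw [hqt]; ring
    rw [h3]
    rw [abs_of_neg hneg] at h1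
    linarith

/-- A steeper descent in the first half would persist, up to the exponential factor, over a
remaining length of at least `(b - a) / 2`, and bring `z` to zero by time `b`. -/
theorem neg_mul_lt_deriv (h : IsShootingSolution G μ a b z q) (hG : IsShootingField G D p C c)
    (hμ : 0 ≤ μ) (hc : 0 ≤ c) (hC : 0 < C) (hab : a < b) (hpos : ∀ t ∈ Ioc a b, 0 < z t) :
    ∀ t ∈ Ioc a ((a + b) / 2),
      -(2 / (b - a) * Real.exp ((C + 1) * (b - a))) * z t < q t := by
  intro s hs
  by_contra! hcon
  set E := Real.exp ((C + 1) * (b - a)) with hE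
  have hE0 : 0 < E := Real.exp_pos _
  have hsb : s < b := by linarith [hs.2]
  have hzs := hpos s ⟨hs.1, hsb.le⟩
  have hba : 0 < b - a := by linarith
  have hq : q s < 0 := by
    refine hcon.trans_lt ?_
    have : 0 < 2 / (b - a) * E * z s := by positivity
    linarith
  have h1 : ∀ t ∈ Icc s b, q t ≤ q s * E⁻¹ := fun t ht => by
    refine (h.deriv_le_of_neg hG hμ hc hs.1.le hq t ht).trans ?_
    refine mul_le_mul_of_nonpos_left ?_ hq.le
    rw [hE, ← Real.exp_neg]
    refine Real.exp_le_exp.2 ?_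
    have : (C + 1) * (t - s) ≤ (C + 1) * (b - a) :=
      mul_le_mul_of_nonneg_left (by linarith [ht.2, hs.1]) (by linarith)
    linarith
  have h2 := image_le_add_mul_of_deriv_le h.hasDeriv hs.1.le le_rfl
    (fun t ht => h1 t (Ico_subset_Icc_self ht)) b ⟨hsb.le, le_rfl⟩
  have h3 : q s * E⁻¹ ≤ -(2 / (b - a)) * z s := by
    calc q s * E⁻¹ ≤ (-(2 / (b - a) * E) * z s) * E⁻¹ :=
          mul_le_mul_of_nonneg_right hcon (inv_nonneg.2 hE0.le)
      _ = -(2 / (b - a)) * z s := by field_simp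
  have h4 : q s * E⁻¹ * (b - s) ≤ -(2 / (b - a)) * z s * ((b - a) / 2) := by
    have hneg : -(2 / (b - a)) * z s ≤ 0 := by
      have : 0 < 2 / (b - a) * z s := by positivity
      linarith
    calc q s * E⁻¹ * (b - s) ≤ -(2 / (b - a)) * z s * (b - s) :=
          mul_le_mul_of_nonneg_right h3 (by linarith)
      _ ≤ _ := mul_le_mul_of_nonpos_left (by linarith [hs.2]) hneg
  have h5 : -(2 / (b - a)) * z s * ((b - a) / 2) = -z s := by field_simp
  have := hpos b ⟨hab, le_rfl⟩
  linarith

theorem mul_exp_le (h : IsShootingSolution G μ a b z q) (hG : IsShootingField G D p C c)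
    (hμ : 0 ≤ μ) (hc : 0 ≤ c) (hC : 0 < C) (hab : a < b) (hpos : ∀ t ∈ Ioc a b, 0 < z t)
    {s : ℝ} (hs : a < s) : ∀ t ∈ Icc s ((a + b) / 2),
      z s * Real.exp (-(2 / (b - a) * Real.exp ((C + 1) * (b - a))) * (t - s)) ≤ z t := by
  set H := 2 / (b - a) * Real.exp ((C + 1) * (b - a)) with hH
  have key : ∀ t ∈ Icc s ((a + b) / 2), -z t ≤ -(z s * Real.exp (-H * (t - s))) := by
    refine image_le_of_hasDerivWithinAt_Icc (f := fun t => -z t) (f' := fun t => -q t)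
      (B := fun t => -(z s * Real.exp (-H * (t - s))))
      (B' := fun t => -(z s * (Real.exp (-H * (t - s)) * -H)))
      (fun t ht => (h.hasDeriv t ht).neg) hs.le (by linarith) (by simp)
      (fun t => ?_) fun t ht hzt => ?_
    · have : HasDerivAt (fun t => -H * (t - s)) (-H) t := by
        simpa using ((hasDerivAt_id t).sub_const s).const_mul (-H)
      exact (this.exp.const_mul _).neg
    · have h1 := h.neg_mul_lt_deriv hG hμ hc hC hab hpos t ⟨hs.trans_le ht.1, ht.2.le⟩
      have h2 : -(z s * (Real.exp (-H * (t - s)) * -H)) = H * z t := by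
        rw [neg_inj.1 hzt]; ring
      rw [h2]
      show -q t < H * z t
      linarith
  intro t ht
  linarith [key t ht]

end IsShootingSolution

/-- The early growth and the Harnack-type bound `mul_exp_le` give `z ≥ η` on `[a + τ, (a + b) / 2]`,
so there the forcing dominates `(C² + B²) / 2 * z`. The Prüfer angle `arctan (z' / (B z))` then
decreases at rate at least `B / 2`. Over a length of at least `(b - a) / 4` this is a drop of at
least `π`, impossible for an arctangent. -/
theorem IsShootingSolution.false_of_large {G : ℝ → ℝ → ℝ → ℝ → ℝ} {p C c μ a b : ℝ}
    {z q : ℝ → ℝ} (h : IsShootingSolution G μ a b z q) (hG : IsShootingField G (b - a) p C c)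
    (hμ : 0 ≤ μ) (hc : 0 < c) (hC : 0 < C) (hp : 1 < p) (hab : a < b)
    (hpos : ∀ t ∈ Ioc a b, 0 < z t) {τ : ℝ} (hτ : 0 < τ) (hτD : τ ≤ (b - a) / 4)
    (hsmall : (C + 1 + C * μ * τ ^ p) * τ ≤ 1 / 2)
    (hlarge : (C ^ 2 + (8 * Real.pi / (b - a)) ^ 2) / 2 ≤ c * μ * (τ / 2 *
      Real.exp (-(2 / (b - a) * Real.exp ((C + 1) * (b - a))) * (b - a))) ^ (p - 1)) :
    False := by
  have hD : 0 < b - a := by linarith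
  set H := 2 / (b - a) * Real.exp ((C + 1) * (b - a)) with hH
  have hH0 : 0 < H := by positivity
  set B := 8 * Real.pi / (b - a) with hBdef
  have hB : 0 < B := by have := Real.pi_pos; positivity
  set η := τ / 2 * Real.exp (-H * (b - a)) with hη
  have hη0 : 0 < η := by positivity
  set s := a + τ with hs
  have has : a < s := by linarith
  have hsub : Icc s ((a + b) / 2) ⊆ Icc a b := Icc_subset_Icc has.le (by linarith)
  have hlow : ∀ t ∈ Icc s ((a + b) / 2), η ≤ z t := fun t ht => by
    refine le_trans ?_ (h.mul_exp_le hG hμ hc.le hC hab hpos has t ht)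
    have h1 : τ / 2 ≤ z s := by
      have := h.half_mul_le hG hμ hC hp hτ.le (by linarith) hsmall s ⟨has.le, le_rfl⟩
      rw [hs] at this ⊢
      linarith
    have h2 : -H * (b - a) ≤ -H * (t - s) := by
      have : H * (t - s) ≤ H * (b - a) :=
        mul_le_mul_of_nonneg_left (by linarith [ht.2]) hH0.le
      linarith
    exact mul_le_mul h1 (Real.exp_le_exp.2 h2) (Real.exp_pos _).le (by linarith)
  have hzpos : ∀ t ∈ Icc s ((a + b) / 2), 0 < z t := fun t ht => hη0.trans_le (hlow t ht)
  have hforce : ∀ t ∈ Icc s ((a + b) / 2),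
      (C ^ 2 + B ^ 2) / 2 * z t ≤ c * μ * clampPow (b - a) p (z t) := fun t ht => by
    have hz := hzpos t ht
    rw [clampPow_eq hz.le
      ((h.le_sub hG hμ t (hsub ht)).trans (by linarith [(hsub ht).2]))]
    have h1 : z t ^ p = z t ^ (p - 1) * z t := by
      rw [← Real.rpow_add_one hz.ne', sub_add_cancel]
    have h2 : η ^ (p - 1) ≤ z t ^ (p - 1) :=
      Real.rpow_le_rpow hη0.le (hlow t ht) (by linarith)
    rw [h1, ← mul_assoc]
    exact mul_le_mul_of_nonneg_right
      (hlarge.trans (mul_le_mul_of_nonneg_left h2 (by positivity))) hz.le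
  have hsm : s ≤ (a + b) / 2 := by rw [hs]; linarith
  have key := image_le_add_mul_of_deriv_le (a := s) (b := (a + b) / 2) (s := s)
    (r := (a + b) / 2) (K := -(B / 2)) (f := fun t => Real.arctan (q t / (B * z t)))
    (f' := fun t => 1 / (1 + (q t / (B * z t)) ^ 2) *
      ((G μ t (z t) (q t) * (B * z t) - q t * (B * q t)) / (B * z t) ^ 2))
    (fun t ht => ?_) le_rfl le_rfl (fun t ht => ?_) _ ⟨hsm, le_rfl⟩
  · have h1 := Real.neg_pi_div_two_lt_arctan (q ((a + b) / 2) / (B * z ((a + b) / 2)))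
    have h2 := Real.arctan_lt_pi_div_two (q s / (B * z s))
    have h3 : B / 2 * ((b - a) / 4) ≤ B / 2 * ((a + b) / 2 - s) :=
      mul_le_mul_of_nonneg_left (by rw [hs]; linarith) (by positivity)
    have h4 : B / 2 * ((b - a) / 4) = Real.pi := by rw [hBdef]; field_simp; norm_num
    linarith
  · exact (((h.hasDeriv_deriv t (hsub ht)).mono hsub).div
      (((h.hasDeriv t (hsub ht)).mono hsub).const_mul B)
      (mul_pos hB (hzpos t ht)).ne').arctan
  · have ht' := Ico_subset_Icc_self ht
    have hz := hzpos t ht'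
    have h1 := hG.upper μ t (z t) (q t) hμ
    have h2 := hforce t ht'
    set g := G μ t (z t) (q t)
    have h3 : g * z t ≤ (C * |q t| - (C ^ 2 + B ^ 2) / 2 * z t) * z t :=
      mul_le_mul_of_nonneg_right (by linarith) hz.le
    -- Young's inequality `C |q| z ≤ q² / 2 + C² z² / 2` absorbs the first-order term.
    have h4 : g * z t ≤ q t ^ 2 / 2 - B ^ 2 / 2 * z t ^ 2 := by
      nlinarith [sq_nonneg (|q t| - C * z t), sq_abs (q t)]
    have h5 : 1 / (1 + (q t / (B * z t)) ^ 2) *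
        ((g * (B * z t) - q t * (B * q t)) / (B * z t) ^ 2) =
        B * (g * z t - q t ^ 2) / (B ^ 2 * z t ^ 2 + q t ^ 2) := by
      field_simp
    rw [h5, div_le_iff₀ (by positivity)]
    nlinarith [mul_le_mul_of_nonneg_left h4 hB.le]

/-! ### Choice of the shooting parameter -/

namespace IsShootingField

variable {G : ℝ → ℝ → ℝ → ℝ → ℝ} {p C c a b : ℝ}

theorem exists_solution_nonpos (hG : IsShootingField G (b - a) p C c) (hc : 0 < c) (hC : 0 < C)
    (hp : 1 < p) (hab : a < b) : ∃ M, 0 < M ∧ ∀ z q, IsShootingSolution G M a b z q →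
      ∃ t ∈ Ioc a b, z t ≤ 0 := by
  have hD : 0 < b - a := by linarith
  set k := 1 / 2 * Real.exp (-(2 / (b - a) * Real.exp ((C + 1) * (b - a))) * (b - a)) with hk
  have hk0 : 0 < k := by positivity
  set V := (C ^ 2 + (8 * Real.pi / (b - a)) ^ 2) / 2 with hV
  have hV0 : 0 < V := by positivity
  set κ := c * (1 / (4 * C)) * k ^ (p - 1) / V with hκ
  have hκ0 : 0 < κ := by positivity
  set τ := min ((b - a) / 4) (min (1 / (4 * (C + 1))) (Real.sqrt κ)) with hτ
  have hτ0 : 0 < τ := lt_min (by positivity) (lt_min (by positivity) (Real.sqrt_pos.2 hκ0))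
  have hτ1 : τ ≤ (b - a) / 4 := min_le_left _ _
  have hτ2 : (C + 1) * τ ≤ 1 / 4 := by
    have : τ ≤ 1 / (4 * (C + 1)) := (min_le_right _ _).trans (min_le_left _ _)
    rw [le_div_iff₀ (by positivity)] at this
    linarith
  have hτ3 : τ ^ 2 ≤ κ := by
    have : τ ≤ Real.sqrt κ := (min_le_right _ _).trans (min_le_right _ _)
    calc τ ^ 2 ≤ Real.sqrt κ ^ 2 := by gcongr
      _ = κ := Real.sq_sqrt hκ0.le
  have hP : 0 < τ ^ (p - 1) := Real.rpow_pos_of_pos hτ0 _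
  have hτp : τ ^ p = τ ^ (p - 1) * τ := by rw [← Real.rpow_add_one hτ0.ne', sub_add_cancel]
  -- Early growth needs `M τ^(p+1)` bounded, the angle argument needs `M τ^(p-1)` large. Fixing the
  -- first at `1 / (4 C)` makes the second of order `τ⁻²`, and `τ² ≤ κ` is exactly the threshold.
  set M := 1 / (4 * C) / (τ ^ (p - 1) * τ ^ 2) with hM
  have hM0 : 0 < M := by positivity
  refine ⟨M, hM0, fun z q h => ?_⟩
  by_contra! hpos
  refine h.false_of_large hG hM0.le hc hC hp hab hpos hτ0 hτ1 ?_ ?_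
  · have : C * M * τ ^ p * τ = 1 / 4 := by
      rw [hM, hτp]; field_simp
    linarith
  · rw [← hV, show τ / 2 * Real.exp (-(2 / (b - a) * Real.exp ((C + 1) * (b - a))) * (b - a))
      = τ * k by rw [hk]; ring, Real.mul_rpow hτ0.le hk0.le]
    have : c * M * (τ ^ (p - 1) * k ^ (p - 1)) = c * (1 / (4 * C)) * k ^ (p - 1) / τ ^ 2 := by
      rw [hM]; field_simp
    rw [this, le_div_iff₀ (by positivity)]
    have := mul_le_mul_of_nonneg_left hτ3 hV0.le
    rwa [hκ, mul_div_cancel₀ _ hV0.ne'] at this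

theorem exists_dist_le_mul (hG : IsShootingField G (b - a) p C c) (M : ℝ) :
    ∃ K : ℝ≥0, ∀ μ ∈ Icc 0 M, ∀ ν ∈ Icc 0 M, ∀ z q z' q', IsShootingSolution G μ a b z q →
      IsShootingSolution G ν a b z' q' → ∀ t ∈ Icc a b, dist (z t) (z' t) ≤ K * dist μ ν := by
  obtain ⟨K, hK⟩ := hG.lipschitz M
  obtain ⟨C', hC'⟩ := hG.param
  -- Passing to `K + 1` avoids the degenerate case of a zero constant in Grönwall's bound.
  have hK1 : ∀ μ ∈ Icc 0 M, ∀ r,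
      LipschitzWith (K + 1) fun x : ℝ × ℝ => (x.2, G μ r x.1 x.2) := fun μ hμ r =>
    (hK μ hμ r).weaken (by simp)
  set E := Real.exp ((K + 1) * (b - a)) with hE
  refine ⟨C' * E.toNNReal, fun μ hμ ν hν z q z' q' h h' t ht => ?_⟩
  have hd : dist μ ν = |μ - ν| := Real.dist_eq _ _
  have key := dist_le_of_approx_trajectories_ODE (K := K + 1) (δ := 0) (εf := 0)
    (εg := C' * |μ - ν|)
    (v := fun r (x : ℝ × ℝ) => (x.2, G μ r x.1 x.2)) (hK1 μ hμ)
    (fun s hs => (h.hasDerivWithinAt_prodMk hs).continuousWithinAt)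
    (fun s hs => (h.hasDerivWithinAt_prodMk (Ico_subset_Icc_self hs)).mono_of_mem_nhdsWithin
      (Icc_mem_nhdsGE_of_mem hs)) (fun s _ => by simp)
    (fun s hs => (h'.hasDerivWithinAt_prodMk hs).continuousWithinAt)
    (fun s hs => (h'.hasDerivWithinAt_prodMk (Ico_subset_Icc_self hs)).mono_of_mem_nhdsWithin
      (Icc_mem_nhdsGE_of_mem hs)) (fun s _ => ?_)
    (by simp [h.init, h.init_deriv, h'.init, h'.init_deriv]) t ht
  · have h1 : dist (z t) (z' t) ≤ gronwallBound 0 ((K + 1 : ℝ≥0) : ℝ) (0 + C' * |μ - ν|) (t - a) :=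
      le_trans (le_max_left _ _) key
    have hne : ((K + 1 : ℝ≥0) : ℝ) ≠ 0 := by positivity
    rw [gronwallBound_of_K_ne_0 hne] at h1
    have h2 : Real.exp (((K + 1 : ℝ≥0) : ℝ) * (t - a)) ≤ E := by
      rw [hE]
      push_cast
      have : t - a ≤ b - a := by linarith [ht.2]
      gcongr
    have h3 : (0 + C' * |μ - ν|) / ((K + 1 : ℝ≥0) : ℝ) ≤ C' * |μ - ν| := by
      rw [zero_add]
      refine div_le_self (by positivity) ?_
      push_cast
      linarith [K.2]
    have h4 : 0 ≤ Real.exp (((K + 1 : ℝ≥0) : ℝ) * (t - a)) - 1 := by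
      rw [sub_nonneg]
      refine Real.one_le_exp (mul_nonneg (NNReal.coe_nonneg _) (by linarith [ht.1]))
    rw [hd, NNReal.coe_mul, Real.coe_toNNReal _ (Real.exp_pos _).le]
    have h5 : (0 : ℝ) ≤ C' * |μ - ν| := by positivity
    calc _ ≤ _ := h1
      _ ≤ C' * |μ - ν| * E := by
        simp only [zero_mul]
        rw [zero_add (_ * _)]
        exact mul_le_mul h3 (by linarith) h4 h5
      _ = _ := by ring
  · rw [Prod.dist_eq, dist_self]
    refine max_le (by positivity) ?_
    rw [Real.dist_eq, abs_sub_comm μ ν]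
    exact hC' _ _ _ _ _

theorem exists_solution_dirichlet (hG : IsShootingField G (b - a) p C c) (hc : 0 < c)
    (hC : 0 < C) (hp : 1 < p) (hab : a < b) :
    ∃ μ z q, 0 < μ ∧ IsShootingSolution G μ a b z q ∧ z b = 0 ∧ (∀ t ∈ Ioo a b, 0 < z t) := by
  have hD : 0 < b - a := by linarith
  obtain ⟨M, hM, hMz⟩ := hG.exists_solution_nonpos hc hC hp hab
  have hex : ∀ μ : Icc 0 M, ∃ zq : (ℝ → ℝ) × (ℝ → ℝ), IsShootingSolution G μ a b zq.1 zq.2 :=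
    fun μ => by
      obtain ⟨z, q, h⟩ := hG.exists_solution hD hp μ.2.1 hab.le
      exact ⟨(z, q), h⟩
  choose zq hzq using hex
  -- A starting interval uniform in `μ`, on which `z ≥ (t - a) / 2`. Minimizing only over `[a + τ,
  -- b]` then discards the prescribed zero at `a`.
  obtain ⟨τ, hτ0, hτb, hτ⟩ : ∃ τ, 0 < τ ∧ a + τ < b ∧
      ∀ μ ∈ Icc 0 M, (C + 1 + C * μ * τ ^ p) * τ ≤ 1 / 2 := by
    set A := C + 1 + C * M with hA
    have hA0 : 0 < A := by positivity
    refine ⟨min ((b - a) / 2) (min 1 (1 / (2 * A))), by positivity, ?_, fun μ hμ => ?_⟩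
    · linarith [min_le_left ((b - a) / 2) (min 1 (1 / (2 * A)))]
    · set τ := min ((b - a) / 2) (min 1 (1 / (2 * A))) with hτ
      have hτ0 : 0 < τ := by positivity
      have h1 : τ ≤ 1 := (min_le_right _ _).trans (min_le_left _ _)
      have h2 : τ ≤ 1 / (2 * A) := (min_le_right _ _).trans (min_le_right _ _)
      have h3 : τ ^ p ≤ 1 := Real.rpow_le_one hτ0.le h1 (by linarith)
      have h4 : C * μ * τ ^ p ≤ C * M := by
        calc C * μ * τ ^ p ≤ C * μ * 1 :=
              mul_le_mul_of_nonneg_left h3 (mul_nonneg hC.le hμ.1)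
          _ ≤ C * M := by rw [mul_one]; exact mul_le_mul_of_nonneg_left hμ.2 hC.le
      calc _ ≤ A * τ := mul_le_mul_of_nonneg_right (by rw [hA]; linarith) hτ0.le
        _ ≤ A * (1 / (2 * A)) := mul_le_mul_of_nonneg_left h2 hA0.le
        _ = 1 / 2 := by field_simp
  have hearly : ∀ μ : Icc 0 M, ∀ t ∈ Icc a (a + τ), 1 / 2 * (t - a) ≤ (zq μ).1 t := fun μ =>
    (hzq μ).half_mul_le hG μ.2.1 hC hp hτ0.le hτb.le (hτ μ μ.2)
  set f : Icc 0 M → ℝ → ℝ := fun μ t => (zq μ).1 (projIcc a b hab.le t) with hf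
  obtain ⟨K, hK⟩ := hG.exists_dist_le_mul M
  have hzc : ∀ μ, ContinuousOn (zq μ).1 (Icc a b) := fun μ t ht =>
    ((hzq μ).hasDeriv t ht).continuousWithinAt
  have hfc : Continuous ↿f := by
    refine continuous_prod_of_continuous_lipschitzWith _ K (fun μ => ?_) fun t => ?_
    · exact (continuousOn_iff_continuous_domRestrict.1 (hzc μ)).comp continuous_projIcc
    · exact LipschitzWith.of_dist_le_mul fun μ ν =>
        hK μ μ.2 ν ν.2 _ _ _ _ (hzq μ) (hzq ν) _ (projIcc a b hab.le t).2
  have hcomp : IsCompact (Icc (a + τ) b) := isCompact_Icc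
  have hsub : Icc (a + τ) b ⊆ Icc a b := Icc_subset_Icc_left (by linarith)
  have hfz : ∀ μ, ∀ t ∈ Icc a b, f μ t = (zq μ).1 t := fun μ t ht => by
    simp [hf, projIcc_of_mem hab.le ht]
  have hft : ∀ μ, Continuous (f μ) := fun μ => hfc.comp (continuous_const.prodMk continuous_id)
  have hne : (Icc (a + τ) b).Nonempty := nonempty_Icc.2 hτb.le
  have hmin : ∀ μ, ∃ t ∈ Icc (a + τ) b, sInf (f μ '' Icc (a + τ) b) = (zq μ).1 t ∧
      ∀ s ∈ Icc (a + τ) b, (zq μ).1 t ≤ (zq μ).1 s := fun μ => by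
    obtain ⟨t, ht, h1, h2⟩ := hcomp.exists_sInf_image_eq_and_le hne (hft μ).continuousOn
    refine ⟨t, ht, by rw [h1, hfz μ t (hsub ht)], fun s hs => ?_⟩
    rw [← hfz μ t (hsub ht), ← hfz μ s (hsub hs)]
    exact h2 s hs
  have hcont : Continuous fun μ => sInf (f μ '' Icc (a + τ) b) := hcomp.continuous_sInf hfc
  have h0 : 0 < sInf (f ⟨0, le_rfl, hM.le⟩ '' Icc (a + τ) b) := by
    obtain ⟨t, ht, h1, -⟩ := hmin ⟨0, le_rfl, hM.le⟩
    have h := hzq ⟨0, le_rfl, hM.le⟩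
    set z := (zq ⟨0, le_rfl, hM.le⟩).1
    set q := (zq ⟨0, le_rfl, hM.le⟩).2
    rw [h1]
    have hqc : ContinuousOn q (Icc a b) := fun t ht => (h.hasDeriv_deriv t ht).continuousWithinAt
    -- For `μ = 0` every constant is a solution, so the slope cannot vanish and never changes sign.
    have hq : ∀ s ∈ Icc a b, 0 ≤ q s := fun s hs => by
      by_contra! hneg
      have hsub' : Icc a s ⊆ Icc a b := Icc_subset_Icc_right hs.2
      obtain ⟨r, hr, hr0⟩ := intermediate_value_Icc' hs.1 (hqc.mono hsub')
        (⟨hneg.le, by rw [h.init_deriv]; exact zero_le_one⟩ : (0 : ℝ) ∈ Icc (q s) (q a))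
      exact h.deriv_ne_zero hG le_rfl (hsub' hr) (fun s => hG.apply_zero_param s _) hr0
    have h2 := image_ge_add_mul_of_le_deriv h.hasDeriv (by linarith : a ≤ a + τ) le_rfl
      (fun s hs => hq s (hsub (Ico_subset_Icc_self hs))) t ht
    have h3 := hearly ⟨0, le_rfl, hM.le⟩ (a + τ) ⟨by linarith, le_rfl⟩
    have h4 : 0 < 1 / 2 * (a + τ - a) := by linarith
    rw [zero_mul, add_zero] at h2
    exact (h4.trans_le h3).trans_le h2
  have h1 : sInf (f ⟨M, hM.le, le_rfl⟩ '' Icc (a + τ) b) ≤ 0 := by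
    obtain ⟨t, ht, h1, h2⟩ := hmin ⟨M, hM.le, le_rfl⟩
    obtain ⟨s, hs, hs0⟩ := hMz _ _ (hzq ⟨M, hM.le, le_rfl⟩)
    rw [h1]
    refine (h2 s ⟨?_, hs.2⟩).trans hs0
    by_contra! hlt
    have := hearly ⟨M, hM.le, le_rfl⟩ s ⟨hs.1.le, hlt.le⟩
    linarith [hs.1]
  have : PreconnectedSpace (Icc 0 M) := Subtype.preconnectedSpace isPreconnected_Icc
  obtain ⟨μ, hμ⟩ := mem_range_of_exists_le_of_exists_ge hcont ⟨_, h1⟩ ⟨_, h0.le⟩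
  have h := hzq μ
  replace hμ : sInf (f μ '' Icc (a + τ) b) = 0 := hμ
  obtain ⟨t, ht, ht1, ht2⟩ := hmin μ
  rw [hμ] at ht1
  set z := (zq μ).1
  set q := (zq μ).2
  have hpos : ∀ s ∈ Ioo a b, 0 < z s := fun s hs => by
    rcases le_or_gt s (a + τ) with hle | hgt
    · have h3 : 1 / 2 * (s - a) ≤ z s := hearly μ s ⟨hs.1.le, hle⟩
      linarith [hs.1]
    · refine lt_of_le_of_ne (ht1 ▸ ht2 s ⟨hgt.le, hs.2.le⟩) fun hz0 => ?_
      have hloc : IsLocalMin z s := by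
        filter_upwards [Ioo_mem_nhds hgt hs.2] with r hr
        rw [← hz0, ht1]
        exact ht2 r (Ioo_subset_Icc_self hr)
      have hs' : s ∈ Icc a b := Ioo_subset_Icc_self hs
      refine h.deriv_ne_zero hG μ.2.1 hs' (fun r => ?_)
        (hloc.hasDerivAt_eq_zero ((h.hasDeriv s hs').hasDerivAt (Icc_mem_nhds hs.1 hs.2)))
      rw [← hz0]
      exact hG.apply_zero hD hp μ.2.1 r
  refine ⟨μ, z, q, lt_of_le_of_ne μ.2.1 fun hμ0 => ?_, h, ?_, hpos⟩
  · have : (⟨0, le_rfl, hM.le⟩ : Icc 0 M) = μ := Subtype.ext hμ0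
    rw [this, hμ] at h0
    exact lt_irrefl _ h0
  · rcases eq_or_lt_of_le ht.2 with heq | hlt
    · rw [← heq, ← ht1]
    · exact absurd ht1.symm (hpos t ⟨by linarith [ht.1], hlt⟩).ne'

end IsShootingField

/-! ### The scalar Pucci function -/

/-- The function `s ↦ α s⁺ - β s⁻`. -/
noncomputable def pucciWeight (α β s : ℝ) : ℝ := α * max s 0 + β * min s 0

theorem pucciWeight_of_nonneg (α β : ℝ) {s : ℝ} (hs : 0 ≤ s) : pucciWeight α β s = α * s := by
  simp [pucciWeight, hs]

theorem pucciWeight_of_nonpos (α β : ℝ) {s : ℝ} (hs : s ≤ 0) : pucciWeight α β s = β * s := by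
  simp [pucciWeight, hs]

@[simp]
theorem pucciWeight_zero (α β : ℝ) : pucciWeight α β 0 = 0 := by
  simp [pucciWeight]

theorem pucciWeight_neg (α β s : ℝ) : pucciWeight α β (-s) = -pucciWeight β α s := by
  rcases le_total 0 s with h | h
  · rw [pucciWeight_of_nonpos _ _ (neg_nonpos.2 h), pucciWeight_of_nonneg _ _ h, mul_neg]
  · rw [pucciWeight_of_nonneg _ _ (neg_nonneg.2 h), pucciWeight_of_nonpos _ _ h, mul_neg]

theorem pucciWeight_mul (α β s : ℝ) {c : ℝ} (hc : 0 ≤ c) :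
    pucciWeight α β (c * s) = c * pucciWeight α β s := by
  rcases le_total 0 s with h | h
  · rw [pucciWeight_of_nonneg _ _ h, pucciWeight_of_nonneg _ _ (mul_nonneg hc h)]; ring
  · rw [pucciWeight_of_nonpos _ _ h,
      pucciWeight_of_nonpos _ _ (mul_nonpos_of_nonneg_of_nonpos hc h)]; ring

theorem pucciWeight_inv_pucciWeight {α β : ℝ} (hα : 0 < α) (hβ : 0 < β) (s : ℝ) :
    pucciWeight α⁻¹ β⁻¹ (pucciWeight α β s) = s := by
  rcases le_total 0 s with h | h
  · rw [pucciWeight_of_nonneg _ _ h, pucciWeight_of_nonneg _ _ (mul_nonneg hα.le h),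
      inv_mul_cancel_left₀ hα.ne']
  · rw [pucciWeight_of_nonpos _ _ h,
      pucciWeight_of_nonpos _ _ (mul_nonpos_of_nonneg_of_nonpos hβ.le h),
      inv_mul_cancel_left₀ hβ.ne']

theorem pucciWeight_pucciWeight_inv {α β : ℝ} (hα : 0 < α) (hβ : 0 < β) (s : ℝ) :
    pucciWeight α β (pucciWeight α⁻¹ β⁻¹ s) = s := by
  simpa using pucciWeight_inv_pucciWeight (inv_pos.2 hα) (inv_pos.2 hβ) s

theorem pucciWeight_sub_ge {α β k x y : ℝ} (hα : k ≤ α) (hβ : k ≤ β) (h : x ≤ y) :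
    k * (y - x) ≤ pucciWeight α β y - pucciWeight α β x := by
  have h1 : max x 0 ≤ max y 0 := max_le_max_right 0 h
  have h2 : min x 0 ≤ min y 0 := min_le_min_right 0 h
  have h3 := mul_le_mul_of_nonneg_right hα (sub_nonneg.2 h1)
  have h4 := mul_le_mul_of_nonneg_right hβ (sub_nonneg.2 h2)
  have h5 := max_add_min x 0
  have h6 := max_add_min y 0
  have h7 : k * (y - x) = k * (max y 0 - max x 0) + k * (min y 0 - min x 0) := by
    rw [← mul_add]; congr 1; linarith
  simp only [pucciWeight]
  linarith

theorem pucciWeight_sub_le {α β K x y : ℝ} (hα : α ≤ K) (hβ : β ≤ K) (h : x ≤ y) :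
    pucciWeight α β y - pucciWeight α β x ≤ K * (y - x) := by
  have h1 : max x 0 ≤ max y 0 := max_le_max_right 0 h
  have h2 : min x 0 ≤ min y 0 := min_le_min_right 0 h
  have h3 := mul_le_mul_of_nonneg_right hα (sub_nonneg.2 h1)
  have h4 := mul_le_mul_of_nonneg_right hβ (sub_nonneg.2 h2)
  have h5 := max_add_min x 0
  have h6 := max_add_min y 0
  have h7 : K * (y - x) = K * (max y 0 - max x 0) + K * (min y 0 - min x 0) := by
    rw [← mul_add]; congr 1; linarith
  simp only [pucciWeight]
  linarith

theorem abs_pucciWeight_sub_le {α β K : ℝ} (hα0 : 0 ≤ α) (hβ0 : 0 ≤ β) (hα : α ≤ K)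
    (hβ : β ≤ K) (x y : ℝ) : |pucciWeight α β x - pucciWeight α β y| ≤ K * |x - y| := by
  wlog h : x ≤ y generalizing x y
  · rw [abs_sub_comm, abs_sub_comm x]; exact this y x (le_of_not_ge h)
  rw [abs_sub_comm, abs_sub_comm x, abs_of_nonneg (sub_nonneg.2 h), abs_of_nonneg]
  · exact pucciWeight_sub_le hα hβ h
  · simpa using pucciWeight_sub_ge hα0 hβ0 h

theorem abs_pucciWeight_le {α β K : ℝ} (hα0 : 0 ≤ α) (hβ0 : 0 ≤ β) (hα : α ≤ K)
    (hβ : β ≤ K) (x : ℝ) : |pucciWeight α β x| ≤ K * |x| := by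
  simpa using abs_pucciWeight_sub_le hα0 hβ0 hα hβ x 0

theorem continuous_pucciWeight (α β : ℝ) : Continuous (pucciWeight α β) := by
  unfold pucciWeight
  fun_prop

theorem exists_abs_clampPow_sub_le {D p : ℝ} (hD : 0 < D) (hp : 1 < p) :
    ∃ K, 0 ≤ K ∧ ∀ x y, |clampPow D p x - clampPow D p y| ≤ K * |x - y| := by
  have hlip : LipschitzOnWith (p * D ^ (p - 1)).toNNReal (fun x : ℝ => x ^ p) (Icc 0 D) := by
    refine (convex_Icc 0 D).lipschitzOnWith_of_nnnorm_hasDerivWithin_le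
      (f' := fun x => p * x ^ (p - 1))
      (fun x _ => (Real.hasDerivAt_rpow_const (Or.inr hp.le)).hasDerivWithinAt) fun x hx => ?_
    rw [← NNReal.coe_le_coe, coe_nnnorm, Real.coe_toNNReal _ (by positivity), Real.norm_eq_abs,
      abs_of_nonneg (mul_nonneg (by linarith) (Real.rpow_nonneg hx.1 _))]
    exact mul_le_mul_of_nonneg_left (Real.rpow_le_rpow hx.1 hx.2 (by linarith)) (by linarith)
  have hclamp : LipschitzWith 1 fun x : ℝ => max 0 (min x D) :=
    (LipschitzWith.id.min_const D).const_max 0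
  have hmem : ∀ x : ℝ, max 0 (min x D) ∈ Icc 0 D := fun x =>
    ⟨le_max_left _ _, max_le hD.le (min_le_right _ _)⟩
  refine ⟨(p * D ^ (p - 1)).toNNReal, NNReal.coe_nonneg _, fun x y => ?_⟩
  have h1 := hlip.dist_le_mul _ (hmem x) _ (hmem y)
  have h2 := hclamp.dist_le_mul x y
  rw [Real.dist_eq] at h1 h2
  rw [NNReal.coe_one, one_mul, Real.dist_eq] at h2
  exact h1.trans (mul_le_mul_of_nonneg_left h2 (NNReal.coe_nonneg _))

/-- The right-hand side of the radial equation, solved for the second derivative. -/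
noncomputable def radialField (α β : ℝ) (d ω : ℝ → ℝ) (D p μ r z q : ℝ) : ℝ :=
  pucciWeight α⁻¹ β⁻¹ (-(d r * pucciWeight α β q) - μ * ω r * clampPow D p z)

/-- The inverse weight has slopes between `K⁻¹` and `k⁻¹`, so subtracting the forcing from its
argument lowers its value by an amount between `K⁻¹` and `k⁻¹` times the forcing. The constant `C`
is a sum because it must bound both the first-order and the forcing contributions. -/
theorem isShootingField_radialField {α β k K d₁ k₀ k₁ D p : ℝ} {d ω : ℝ → ℝ} (hk : 0 < k)
    (hα : k ≤ α) (hβ : k ≤ β) (hαK : α ≤ K) (hβK : β ≤ K) (hd : Continuous d)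
    (hω : Continuous ω) (hd0 : ∀ r, 0 < d r) (hd1 : ∀ r, d r ≤ d₁) (hk₀ : 0 < k₀)
    (hω0 : ∀ r, k₀ ≤ ω r) (hω1 : ∀ r, ω r ≤ k₁) (hD : 0 < D) (hp : 1 < p) :
    IsShootingField (radialField α β d ω D p) D p (k⁻¹ * (d₁ * K) + k⁻¹ * k₁) (K⁻¹ * k₀) := by
  have hα0 : 0 < α := hk.trans_le hα
  have hβ0 : 0 < β := hk.trans_le hβ
  have hK0 : 0 < K := hα0.trans_le hαK
  have hα1 : α⁻¹ ≤ k⁻¹ := inv_anti₀ hk hα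
  have hβ1 : β⁻¹ ≤ k⁻¹ := inv_anti₀ hk hβ
  have hα2 : K⁻¹ ≤ α⁻¹ := inv_anti₀ hα0 hαK
  have hβ2 : K⁻¹ ≤ β⁻¹ := inv_anti₀ hβ0 hβK
  have hki : 0 < k⁻¹ := inv_pos.2 hk
  have hKi : 0 < K⁻¹ := inv_pos.2 hK0
  have hd₁ : 0 < d₁ := (hd0 0).trans_le (hd1 0)
  have hk₁ : 0 < k₁ := hk₀.trans_le ((hω0 0).trans (hω1 0))
  have hω' : ∀ r, 0 < ω r := fun r => hk₀.trans_le (hω0 r)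
  have hw : ∀ q, |pucciWeight α β q| ≤ K * |q| :=
    abs_pucciWeight_le hα0.le hβ0.le hαK hβK
  have hinv : ∀ x y, |pucciWeight α⁻¹ β⁻¹ x - pucciWeight α⁻¹ β⁻¹ y| ≤ k⁻¹ * |x - y| :=
    abs_pucciWeight_sub_le (inv_nonneg.2 hα0.le) (inv_nonneg.2 hβ0.le) hα1 hβ1
  have hlin : ∀ r q, |pucciWeight α⁻¹ β⁻¹ (-(d r * pucciWeight α β q))| ≤
      k⁻¹ * (d₁ * K) * |q| := fun r q => by
    have h1 := hinv (-(d r * pucciWeight α β q)) 0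
    rw [pucciWeight_zero, sub_zero, sub_zero, abs_neg, abs_mul, abs_of_pos (hd0 r)] at h1
    refine h1.trans ?_
    rw [mul_assoc, mul_assoc]
    refine mul_le_mul_of_nonneg_left ?_ hki.le
    exact mul_le_mul (hd1 r) (hw q) (abs_nonneg _) hd₁.le
  have hY : ∀ μ r z, 0 ≤ μ → 0 ≤ μ * ω r * clampPow D p z := fun μ r z hμ =>
    mul_nonneg (mul_nonneg hμ (hω' r).le) (clampPow_nonneg _ _ _)
  refine ⟨fun M => ?_, fun μ z q => ?_, fun μ r z q hμ => ?_, fun μ r z q hμ => ?_,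
    fun μ r z q hμ hq => ?_, ?_⟩
  · obtain ⟨Kφ, hKφ0, hKφ⟩ := exists_abs_clampPow_sub_le hD hp
    refine ⟨(1 + k⁻¹ * (d₁ * K + |M| * k₁ * Kφ)).toNNReal, fun μ hμ r =>
      LipschitzWith.of_dist_le_mul fun x y => ?_⟩
    have hL : 0 ≤ k⁻¹ * (d₁ * K + |M| * k₁ * Kφ) := by positivity
    rw [Real.coe_toNNReal _ (by linarith)]
    have hx1 : |x.1 - y.1| ≤ dist x y := le_max_left _ _
    have hx2 : |x.2 - y.2| ≤ dist x y := le_max_right _ _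
    refine max_le ?_ ?_
    · have h0 : dist (x.2, radialField α β d ω D p μ r x.1 x.2).1
        (y.2, radialField α β d ω D p μ r y.1 y.2).1 = |x.2 - y.2| := rfl
      rw [h0]
      nlinarith [dist_nonneg (x := x) (y := y)]
    · have h0 : dist (x.2, radialField α β d ω D p μ r x.1 x.2).2
        (y.2, radialField α β d ω D p μ r y.1 y.2).2 =
          |radialField α β d ω D p μ r x.1 x.2 - radialField α β d ω D p μ r y.1 y.2| := rfl
      rw [h0]
      have h1 : |-(d r * pucciWeight α β x.2) - μ * ω r * clampPow D p x.1 -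
          (-(d r * pucciWeight α β y.2) - μ * ω r * clampPow D p y.1)| ≤
          (d₁ * K + |M| * k₁ * Kφ) * dist x y := by
        have h2 : d r * |pucciWeight α β x.2 - pucciWeight α β y.2| ≤ d₁ * (K * dist x y) :=
          mul_le_mul (hd1 r) ((abs_pucciWeight_sub_le hα0.le hβ0.le hαK hβK _ _).trans
            (mul_le_mul_of_nonneg_left hx2 hK0.le)) (abs_nonneg _) hd₁.le
        have h3 : μ * ω r * |clampPow D p x.1 - clampPow D p y.1| ≤
            |M| * k₁ * (Kφ * dist x y) :=
          mul_le_mul (mul_le_mul (hμ.2.trans (le_abs_self M)) (hω1 r) (hω' r).le (abs_nonneg _))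
            ((hKφ _ _).trans (mul_le_mul_of_nonneg_left hx1 hKφ0)) (abs_nonneg _)
            (by positivity)
        have h4 : -(d r * pucciWeight α β x.2) - μ * ω r * clampPow D p x.1 -
          (-(d r * pucciWeight α β y.2) - μ * ω r * clampPow D p y.1) =
          -(d r * (pucciWeight α β x.2 - pucciWeight α β y.2)) -
            μ * ω r * (clampPow D p x.1 - clampPow D p y.1) := by ring
        rw [h4]
        refine (abs_sub _ _).trans ?_
        rw [abs_neg, abs_mul, abs_mul (μ * ω r), abs_of_pos (hd0 r),
          abs_of_nonneg (mul_nonneg hμ.1 (hω' r).le)]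
        linarith
      refine (hinv _ _).trans ((mul_le_mul_of_nonneg_left h1 hki.le).trans ?_)
      rw [← mul_assoc]
      exact mul_le_mul_of_nonneg_right (by linarith) dist_nonneg
  · have := continuous_pucciWeight α⁻¹ β⁻¹
    unfold radialField
    fun_prop
  · have h1 := pucciWeight_sub_ge hα2 hβ2 (sub_le_self (-(d r * pucciWeight α β q)) (hY μ r z hμ))
    have h2 := (le_abs_self _).trans (hlin r q)
    have h3 : k₀ * (μ * clampPow D p z) ≤ ω r * (μ * clampPow D p z) :=
      mul_le_mul_of_nonneg_right (hω0 r) (mul_nonneg hμ (clampPow_nonneg _ _ _))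
    have h4 := mul_le_mul_of_nonneg_left h3 hKi.le
    have h5 : 0 ≤ k⁻¹ * k₁ * |q| := by positivity
    unfold radialField
    linarith
  · have h1 := pucciWeight_sub_le hα1 hβ1 (sub_le_self (-(d r * pucciWeight α β q)) (hY μ r z hμ))
    have h2 := (neg_le_of_abs_le (hlin r q))
    have h3 : ω r * (μ * clampPow D p z) ≤ k₁ * (μ * clampPow D p z) :=
      mul_le_mul_of_nonneg_right (hω1 r) (mul_nonneg hμ (clampPow_nonneg _ _ _))
    have h4 := mul_le_mul_of_nonneg_left h3 hki.le
    have h5 : 0 ≤ k⁻¹ * k₁ * |q| := by positivity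
    have h6 : 0 ≤ k⁻¹ * (d₁ * K) * (μ * clampPow D p z) :=
      mul_nonneg (by positivity) (mul_nonneg hμ (clampPow_nonneg _ _ _))
    unfold radialField
    linarith
  · have h1 : 0 < d r * pucciWeight α β q := by
      rw [pucciWeight_of_nonneg _ _ hq.le]
      exact mul_pos (hd0 r) (mul_pos hα0 hq)
    have h2 := hY μ r z hμ
    unfold radialField
    rw [pucciWeight_of_nonpos _ _ (by linarith)]
    exact mul_neg_of_pos_of_neg (inv_pos.2 hβ0) (by linarith)
  · refine ⟨(k⁻¹ * (k₁ * D ^ p)).toNNReal, fun μ ν r z q => (hinv _ _).trans ?_⟩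
    have hφ : clampPow D p z ≤ D ^ p :=
      Real.rpow_le_rpow (le_max_left _ _) (max_le hD.le (min_le_right _ _)) (by linarith)
    have h4 : -(d r * pucciWeight α β q) - μ * ω r * clampPow D p z -
        (-(d r * pucciWeight α β q) - ν * ω r * clampPow D p z) =
        -((ω r * clampPow D p z) * (μ - ν)) := by ring
    rw [h4, abs_neg, abs_mul, abs_of_nonneg (mul_nonneg (hω' r).le (clampPow_nonneg _ _ _)),
      Real.coe_toNNReal _ (by positivity), mul_assoc k⁻¹]
    refine mul_le_mul_of_nonneg_left (mul_le_mul_of_nonneg_right ?_ (abs_nonneg _)) hki.le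
    exact mul_le_mul (hω1 r) hφ (clampPow_nonneg _ _ _) hk₁.le

/-! ### Pucci operators at matrices with a simple and an `(N-1)`-fold eigenvalue -/

section Pucci

variable {N : ℕ}

/-- By cyclicity `tr (B Q) = tr (Q B Q)`, and `Q B Q` is positive semidefinite. -/
theorem trace_mul_nonneg_of_isIdempotentElem {B Q : Matrix (Fin N) (Fin N) ℝ}
    (hB : B.PosSemidef) (hQ : Q.IsHermitian) (hQQ : Q * Q = Q) : 0 ≤ (B * Q).trace := by
  have h := (hB.conjTranspose_mul_mul_same Q).trace_nonneg
  rwa [hQ.eq, mul_assoc, Matrix.trace_mul_comm, mul_assoc, hQQ] at h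

theorem posSemidef_of_isIdempotentElem {Q : Matrix (Fin N) (Fin N) ℝ}
    (hQ : Q.IsHermitian) (hQQ : Q * Q = Q) : Q.PosSemidef := by
  have h := Matrix.posSemidef_conjTranspose_mul_self Q
  rwa [hQ.eq, hQQ] at h

theorem trace_mul_mem_Icc {l L : ℝ} {A Q : Matrix (Fin N) (Fin N) ℝ}
    (hA : A ∈ ellipticMatrices N l L) (hQ : Q.IsHermitian) (hQQ : Q * Q = Q) :
    (A * Q).trace ∈ Icc (l * Q.trace) (L * Q.trace) := by
  have h1 := trace_mul_nonneg_of_isIdempotentElem hA.2.1 hQ hQQ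
  have h2 := trace_mul_nonneg_of_isIdempotentElem hA.2.2 hQ hQQ
  simp only [sub_mul, Matrix.smul_mul, one_mul, Matrix.trace_sub, Matrix.trace_smul,
    smul_eq_mul] at h1 h2
  exact ⟨by linarith, by linarith⟩

theorem mul_le_pucciWeight {l L T k t : ℝ} (ht : t ∈ Icc (l * T) (L * T)) :
    k * t ≤ T * pucciWeight L l k := by
  rcases le_total 0 k with h | h
  · rw [pucciWeight_of_nonneg _ _ h]
    nlinarith [ht.1, ht.2]
  · rw [pucciWeight_of_nonpos _ _ h]
    nlinarith [ht.1, ht.2]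

theorem exists_mem_Icc_mul_eq_pucciWeight {l L : ℝ} (hlL : l ≤ L) (k : ℝ) :
    ∃ t ∈ Icc l L, k * t = pucciWeight L l k := by
  rcases le_total 0 k with h | h
  · exact ⟨L, ⟨hlL, le_rfl⟩, by rw [pucciWeight_of_nonneg _ _ h, mul_comm]⟩
  · exact ⟨l, ⟨le_rfl, hlL⟩, by rw [pucciWeight_of_nonpos _ _ h, mul_comm]⟩

/-- The value of `M⁺` at `k Q + g (1 - Q)`, for an orthogonal projection `Q`. -/
theorem pucciPlus_smul_add_smul {l L : ℝ} (hlL : l ≤ L) {Q : Matrix (Fin N) (Fin N) ℝ}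
    (hQ : Q.IsHermitian) (hQQ : Q * Q = Q) (k g : ℝ) :
    pucciPlus l L (k • Q + g • (1 - Q)) =
      Q.trace * pucciWeight L l k + (N - Q.trace) * pucciWeight L l g := by
  have hP : (1 - Q).IsHermitian := Matrix.isHermitian_one.sub hQ
  have hPP : (1 - Q) * (1 - Q) = 1 - Q := by
    rw [mul_sub, mul_one, sub_mul, one_mul, hQQ, sub_self, sub_zero]
  have hQP : Q * (1 - Q) = 0 := by rw [mul_sub, mul_one, hQQ, sub_self]
  have hPQ : (1 - Q) * Q = 0 := by rw [sub_mul, one_mul, hQQ, sub_self]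
  have htP : (1 - Q).trace = N - Q.trace := by simp [Matrix.trace_sub, Matrix.trace_one]
  have hQ0 := posSemidef_of_isIdempotentElem hQ hQQ
  have hP0 := posSemidef_of_isIdempotentElem hP hPP
  rw [← htP]
  refine IsGreatest.csSup_eq ⟨?_, ?_⟩
  · obtain ⟨t, ht, htk⟩ := exists_mem_Icc_mul_eq_pucciWeight hlL k
    obtain ⟨s, hs, hsg⟩ := exists_mem_Icc_mul_eq_pucciWeight hlL g
    -- The maximizer commutes with the matrix and takes `L` or `l` on each eigenspace according to
    -- the sign of the eigenvalue.
    refine ⟨t • Q + s • (1 - Q), ⟨?_, ?_, ?_⟩, ?_⟩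
    · have h1 : Q.transpose = Q := by simpa [Matrix.conjTranspose_eq_transpose_of_trivial] using hQ.eq
      simp [Matrix.IsSymm, h1]
    · have : t • Q + s • (1 - Q) - l • (1 : Matrix (Fin N) (Fin N) ℝ) =
          (t - l) • Q + (s - l) • (1 - Q) := by
        simp only [smul_sub, sub_smul]; abel
      rw [this]
      exact (hQ0.smul (sub_nonneg.2 ht.1)).add (hP0.smul (sub_nonneg.2 hs.1))
    · have : L • (1 : Matrix (Fin N) (Fin N) ℝ) - (t • Q + s • (1 - Q)) =
          (L - t) • Q + (L - s) • (1 - Q) := by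
        simp only [smul_sub, sub_smul]; abel
      rw [this]
      exact (hQ0.smul (sub_nonneg.2 ht.2)).add (hP0.smul (sub_nonneg.2 hs.2))
    · simp only [add_mul, mul_add, Matrix.smul_mul, Matrix.mul_smul, hQQ, hPP, hQP, hPQ,
        smul_zero, add_zero, zero_add, Matrix.trace_add, Matrix.trace_smul, smul_eq_mul]
      rw [← htk, ← hsg]
      ring
  · rintro _ ⟨A, hA, rfl⟩
    simp only [mul_add, Matrix.mul_smul, Matrix.trace_add, Matrix.trace_smul, smul_eq_mul]
    exact add_le_add (mul_le_pucciWeight (trace_mul_mem_Icc hA hQ hQQ))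
      (mul_le_pucciWeight (trace_mul_mem_Icc hA hP hPP))

theorem pucciPlus_neg (l L : ℝ) (X : Matrix (Fin N) (Fin N) ℝ) :
    pucciPlus l L (-X) = -pucciMinus l L X := by
  have : pucciValues l L (-X) = -pucciValues l L X := by
    ext t
    simp only [pucciValues, mem_image, Set.mem_neg, Matrix.mul_neg, Matrix.trace_neg,
      neg_eq_iff_eq_neg]
  rw [pucciPlus, pucciMinus, this, Real.sSup_neg]

theorem pucciMinus_neg (l L : ℝ) (X : Matrix (Fin N) (Fin N) ℝ) :
    pucciMinus l L (-X) = -pucciPlus l L X := by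
  rw [← neg_neg (pucciMinus l L (-X)), ← pucciPlus_neg, neg_neg]

/-- The value of `M⁻` at `k Q + g (1 - Q)`, for an orthogonal projection `Q`. -/
theorem pucciMinus_smul_add_smul {l L : ℝ} (hlL : l ≤ L) {Q : Matrix (Fin N) (Fin N) ℝ}
    (hQ : Q.IsHermitian) (hQQ : Q * Q = Q) (k g : ℝ) :
    pucciMinus l L (k • Q + g • (1 - Q)) =
      Q.trace * pucciWeight l L k + (N - Q.trace) * pucciWeight l L g := by
  have h := pucciPlus_smul_add_smul hlL hQ hQQ (-k) (-g)
  rw [pucciWeight_neg, pucciWeight_neg, neg_smul, neg_smul, ← neg_add, pucciPlus_neg] at h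
  linarith

end Pucci

/-! ### Radial functions -/

section Radial

variable {N : ℕ}

theorem hasFDerivAt_norm_of_ne_zero {x : EuclideanSpace ℝ (Fin N)} (hx : x ≠ 0) :
    HasFDerivAt (fun y : EuclideanSpace ℝ (Fin N) => ‖y‖) (‖x‖⁻¹ • innerSL ℝ x) x := by
  have hx0 : ‖x‖ ≠ 0 := norm_ne_zero_iff.2 hx
  have h1 := ((hasStrictFDerivAt_norm_sq x).hasFDerivAt).sqrt (pow_ne_zero 2 hx0)
  simp only [Real.sqrt_sq (norm_nonneg _)] at h1
  have h2 : 1 / (2 * ‖x‖) * ((2 : ℕ) : ℝ) = ‖x‖⁻¹ := by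
    push_cast
    field_simp
  rwa [← Nat.cast_smul_eq_nsmul ℝ, smul_smul, h2] at h1

theorem hasFDerivAt_radial {w : ℝ → ℝ} {w' : ℝ} {x : EuclideanSpace ℝ (Fin N)} (hx : x ≠ 0)
    (hw : HasDerivAt w w' ‖x‖) :
    HasFDerivAt (fun y : EuclideanSpace ℝ (Fin N) => w ‖y‖) ((w' / ‖x‖) • innerSL ℝ x) x := by
  have h := hw.comp_hasFDerivAt x (hasFDerivAt_norm_of_ne_zero hx)
  rwa [smul_smul, ← div_eq_mul_inv] at h

/-- The orthogonal projection onto the line spanned by `x`. -/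
noncomputable def radialProj (x : EuclideanSpace ℝ (Fin N)) : Matrix (Fin N) (Fin N) ℝ :=
  (‖x‖ ^ 2)⁻¹ • Matrix.vecMulVec x x

theorem isHermitian_radialProj (x : EuclideanSpace ℝ (Fin N)) : (radialProj x).IsHermitian := by
  ext i j
  simp [radialProj, Matrix.vecMulVec_apply, mul_comm]

theorem dotProduct_self_eq_norm_sq (x : EuclideanSpace ℝ (Fin N)) :
    (x : Fin N → ℝ) ⬝ᵥ x = ‖x‖ ^ 2 := by
  rw [EuclideanSpace.real_norm_sq_eq]
  simp [dotProduct, sq]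

theorem radialProj_mul_self {x : EuclideanSpace ℝ (Fin N)} (hx : x ≠ 0) :
    radialProj x * radialProj x = radialProj x := by
  have hx0 : ‖x‖ ≠ 0 := norm_ne_zero_iff.2 hx
  rw [radialProj, Matrix.smul_mul, Matrix.mul_smul, Matrix.vecMulVec_mul_vecMulVec,
    dotProduct_self_eq_norm_sq, Matrix.vecMulVec_smul, smul_smul, smul_smul]
  congr 1
  field_simp

theorem trace_radialProj {x : EuclideanSpace ℝ (Fin N)} (hx : x ≠ 0) :
    (radialProj x).trace = 1 := by
  have hx0 : ‖x‖ ≠ 0 := norm_ne_zero_iff.2 hx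
  rw [radialProj, Matrix.trace_smul, Matrix.trace_vecMulVec, dotProduct_self_eq_norm_sq,
    smul_eq_mul, inv_mul_cancel₀ (pow_ne_zero 2 hx0)]

/-- The gradient is `(w'/r) x`; the product rule gives `(w'/r) I + ((w'/r)'/r) x ⊗ x`, regrouped
along the radial projection. -/
theorem hessian_radial {w w₁ : ℝ → ℝ} {w₂ : ℝ} {x : EuclideanSpace ℝ (Fin N)} (hx : x ≠ 0)
    (hw : ∀ᶠ r in 𝓝 ‖x‖, HasDerivAt w (w₁ r) r) (hw₁ : HasDerivAt w₁ w₂ ‖x‖) :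
    hessian (fun y => w ‖y‖) x =
      w₂ • radialProj x + (w₁ ‖x‖ / ‖x‖) • (1 - radialProj x) := by
  have hx0 : ‖x‖ ≠ 0 := norm_ne_zero_iff.2 hx
  have h1 : fderiv ℝ (fun y : EuclideanSpace ℝ (Fin N) => w ‖y‖) =ᶠ[𝓝 x]
      fun y => (w₁ ‖y‖ / ‖y‖) • innerSL ℝ y := by
    filter_upwards [continuous_norm.continuousAt.eventually hw, isOpen_ne.mem_nhds hx] with y hy hy0
    exact (hasFDerivAt_radial hy0 hy).fderiv
  have h2 : HasDerivAt (fun r => w₁ r / r) ((w₂ * ‖x‖ - w₁ ‖x‖ * 1) / ‖x‖ ^ 2) ‖x‖ :=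
    hw₁.div (hasDerivAt_id _) hx0
  have h3 := (hasFDerivAt_radial hx h2).smul
    (innerSL ℝ : EuclideanSpace ℝ (Fin N) →L[ℝ] EuclideanSpace ℝ (Fin N) →L[ℝ] ℝ).hasFDerivAt
  have h4 := (h3.congr_of_eventuallyEq h1).fderiv
  ext i j
  simp only [hessian, Matrix.of_apply]
  rw [h4]
  have hij : inner ℝ (EuclideanSpace.single i (1 : ℝ)) (EuclideanSpace.single j (1 : ℝ)) =
      (1 : Matrix (Fin N) (Fin N) ℝ) i j := by
    rw [EuclideanSpace.inner_single_left]
    simp [Matrix.one_apply]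
  have hxe : ∀ i, inner ℝ x (EuclideanSpace.single i (1 : ℝ)) = x i := fun i => by
    simp [EuclideanSpace.inner_single_right]
  change w₁ ‖x‖ / ‖x‖ * inner ℝ (EuclideanSpace.single i (1 : ℝ)) (EuclideanSpace.single j (1 : ℝ)) +
    (w₂ * ‖x‖ - w₁ ‖x‖ * 1) / ‖x‖ ^ 2 / ‖x‖ * inner ℝ x (EuclideanSpace.single i (1 : ℝ)) *
      inner ℝ x (EuclideanSpace.single j (1 : ℝ)) = _
  rw [hij, hxe, hxe]
  simp only [radialProj, Matrix.add_apply, Matrix.smul_apply, Matrix.sub_apply,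
    Matrix.vecMulVec_apply, smul_eq_mul]
  field_simp
  ring

theorem contDiffOn_radial {w w₁ w₂ : ℝ → ℝ} {r₁ r₂ : ℝ} (hr₁ : 0 < r₁)
    (hw : ∀ r ∈ Ioo r₁ r₂, HasDerivAt w (w₁ r) r)
    (hw₁ : ∀ r ∈ Ioo r₁ r₂, HasDerivAt w₁ (w₂ r) r) (hw₂ : ContinuousOn w₂ (Ioo r₁ r₂)) :
    ContDiffOn ℝ 2 (fun x : EuclideanSpace ℝ (Fin N) => w ‖x‖) (annulus N r₁ r₂) := by
  have h0 : ∀ {f f' : ℝ → ℝ} {n : ℕ}, (∀ r ∈ Ioo r₁ r₂, HasDerivAt f (f' r) r) →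
      ContDiffOn ℝ n f' (Ioo r₁ r₂) → ContDiffOn ℝ (n + 1) f (Ioo r₁ r₂) := fun hf hf' =>
    (contDiffOn_succ_iff_deriv_of_isOpen isOpen_Ioo).2
      ⟨fun r hr => (hf r hr).differentiableAt.differentiableWithinAt, by simp,
        hf'.congr fun r hr => (hf r hr).deriv⟩
  have h1 : ContDiffOn ℝ 2 w (Ioo r₁ r₂) := by
    have := h0 (n := 1) hw (h0 (n := 0) hw₁ (contDiffOn_zero.2 hw₂))
    exact_mod_cast this
  refine h1.comp (fun x hx => (contDiffAt_norm ℝ ?_).contDiffWithinAt) fun x hx => hx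
  exact norm_pos_iff.1 (hr₁.trans hx.1)

theorem isOpen_annulus (r₁ r₂ : ℝ) : IsOpen (annulus N r₁ r₂) :=
  (isOpen_lt continuous_const continuous_norm).inter (isOpen_lt continuous_norm continuous_const)

theorem norm_mem_Icc_of_mem_closure_annulus {r₁ r₂ : ℝ} {x : EuclideanSpace ℝ (Fin N)}
    (hx : x ∈ closure (annulus N r₁ r₂)) : ‖x‖ ∈ Icc r₁ r₂ := by
  have hcl : IsClosed {x : EuclideanSpace ℝ (Fin N) | ‖x‖ ∈ Icc r₁ r₂} :=
    isClosed_Icc.preimage continuous_norm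
  have hsub : annulus N r₁ r₂ ⊆ {x | ‖x‖ ∈ Icc r₁ r₂} := fun y hy => ⟨hy.1.le, hy.2.le⟩
  exact closure_minimal hsub hcl hx

theorem norm_eq_of_mem_frontier_annulus {r₁ r₂ : ℝ} {x : EuclideanSpace ℝ (Fin N)}
    (hx : x ∈ frontier (annulus N r₁ r₂)) : ‖x‖ = r₁ ∨ ‖x‖ = r₂ := by
  have h1 := norm_mem_Icc_of_mem_closure_annulus hx.1
  by_contra! h
  refine hx.2 ?_
  rw [(isOpen_annulus r₁ r₂).interior_eq]
  exact ⟨lt_of_le_of_ne h1.1 h.1.symm, lt_of_le_of_ne h1.2 h.2⟩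

end Radial

/-! ### The radial boundary value problem -/

theorem exists_radial_profile {α β m a p r₁ r₂ : ℝ} (hα : 0 < α) (hβ : 0 < β) (hm : 0 < m)
    (hp : 1 < p) (hr₁ : 0 < r₁) (hr : r₁ < r₂) :
    ∃ w w₁ w₂ : ℝ → ℝ, w r₁ = 0 ∧ w r₂ = 0 ∧ ContinuousOn w (Icc r₁ r₂) ∧
      (∀ r ∈ Ioo r₁ r₂, 0 < w r) ∧ (∀ r ∈ Ioo r₁ r₂, HasDerivAt w (w₁ r) r) ∧
      (∀ r ∈ Ioo r₁ r₂, HasDerivAt w₁ (w₂ r) r) ∧ ContinuousOn w₂ (Ioo r₁ r₂) ∧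
      ∀ r ∈ Ioo r₁ r₂, pucciWeight α β (w₂ r) + m * pucciWeight α β (w₁ r / r) +
        r ^ a * w r ^ p = 0 := by
  -- Clamping the radius makes the coefficients continuous and bounded on the whole line, as the
  -- shooting conditions ask.
  set ρ : ℝ → ℝ := fun r => max r₁ (min r r₂) with hρ
  have hρc : Continuous ρ := by fun_prop
  have hρ1 : ∀ r, r₁ ≤ ρ r := fun r => le_max_left _ _
  have hρ2 : ∀ r, ρ r ≤ r₂ := fun r => max_le hr.le (min_le_right _ _)
  have hρ0 : ∀ r, 0 < ρ r := fun r => hr₁.trans_le (hρ1 r)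
  have hρeq : ∀ r ∈ Ioo r₁ r₂, ρ r = r := fun r h => by simp [hρ, h.1.le, h.2.le]
  have hdc : Continuous fun r => m / ρ r := continuous_const.div hρc fun r => (hρ0 r).ne'
  have hωc : Continuous fun r => ρ r ^ a := hρc.rpow_const fun r => Or.inl (hρ0 r).ne'
  have hpowc : ContinuousOn (fun r : ℝ => r ^ a) (Icc r₁ r₂) :=
    continuousOn_id.rpow_const fun r h => Or.inl (hr₁.trans_le h.1).ne'
  obtain ⟨s₀, hs₀, hmin⟩ := isCompact_Icc.exists_isMinOn (nonempty_Icc.2 hr.le) hpowc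
  obtain ⟨s₁, hs₁, hmax⟩ := isCompact_Icc.exists_isMaxOn (nonempty_Icc.2 hr.le) hpowc
  have hG := isShootingField_radialField (α := α) (β := β) (k := min α β) (K := max α β)
    (d₁ := m / r₁) (k₀ := s₀ ^ a) (k₁ := s₁ ^ a) (D := r₂ - r₁) (p := p) (lt_min hα hβ)
    (min_le_left _ _) (min_le_right _ _) (le_max_left _ _) (le_max_right _ _) hdc hωc
    (fun r => div_pos hm (hρ0 r)) (fun r => div_le_div_of_nonneg_left hm.le hr₁ (hρ1 r))
    (Real.rpow_pos_of_pos (hr₁.trans_le hs₀.1) a) (fun r => hmin ⟨hρ1 r, hρ2 r⟩)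
    (fun r => hmax ⟨hρ1 r, hρ2 r⟩) (sub_pos.2 hr) hp
  have hs₀' : 0 < s₀ ^ a := Real.rpow_pos_of_pos (hr₁.trans_le hs₀.1) a
  have hs₁' : 0 < s₁ ^ a := Real.rpow_pos_of_pos (hr₁.trans_le hs₁.1) a
  have hK : 0 < max α β := lt_max_of_lt_left hα
  have hk : 0 < min α β := lt_min hα hβ
  obtain ⟨μ, z, q, hμ, h, hb, hpos⟩ := hG.exists_solution_dirichlet (by positivity)
    (by positivity) hp hr
  have hle := h.le_sub hG hμ.le
  -- Chosen so that `s^p = s μ`: multiplying `z` by `s` absorbs the parameter into the power.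
  set s := μ ^ (1 / (p - 1)) with hs
  have hs0 : 0 < s := Real.rpow_pos_of_pos hμ _
  have hsμ : s ^ p = s * μ := by
    have h1 : s ^ (p - 1) = μ := by
      rw [hs, ← Real.rpow_mul hμ.le, one_div_mul_cancel (by linarith), Real.rpow_one]
    rw [← h1, mul_comm, ← Real.rpow_add_one hs0.ne', sub_add_cancel]
  have hzc : ContinuousOn z (Icc r₁ r₂) := fun t ht => (h.hasDeriv t ht).continuousWithinAt
  have hqc : ContinuousOn q (Icc r₁ r₂) := fun t ht =>
    (h.hasDeriv_deriv t ht).continuousWithinAt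
  refine ⟨fun r => s * z r, fun r => s * q r, fun r => s * radialField α β (fun r => m / ρ r)
    (fun r => ρ r ^ a) (r₂ - r₁) p μ r (z r) (q r), by simp [h.init], by simp [hb],
    continuousOn_const.mul hzc, fun r hr' => mul_pos hs0 (hpos r hr'), fun r hr' => ?_,
    fun r hr' => ?_, ?_, fun r hr' => ?_⟩
  · exact ((h.hasDeriv r (Ioo_subset_Icc_self hr')).hasDerivAt
      (Icc_mem_nhds hr'.1 hr'.2)).const_mul s
  · exact ((h.hasDeriv_deriv r (Ioo_subset_Icc_self hr')).hasDerivAt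
      (Icc_mem_nhds hr'.1 hr'.2)).const_mul s
  · have hz' := hzc.mono Ioo_subset_Icc_self
    have hq' := hqc.mono Ioo_subset_Icc_self
    have hφ : Continuous (clampPow (r₂ - r₁) p) :=
      (continuous_const.max (continuous_id.min continuous_const)).rpow_const
        fun _ => Or.inr (by linarith)
    refine continuousOn_const.mul ((continuous_pucciWeight _ _).comp_continuousOn ?_)
    exact ((hdc.continuousOn.mul ((continuous_pucciWeight α β).comp_continuousOn hq')).neg).sub
      ((continuousOn_const.mul hωc.continuousOn).mul (hφ.comp_continuousOn hz'))
  · have hz := hpos r hr'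
    have hr0 : 0 < r := hr₁.trans hr'.1
    have hzD : z r ≤ r₂ - r₁ := (hle r (Ioo_subset_Icc_self hr')).trans (by linarith [hr'.2])
    rw [pucciWeight_mul _ _ _ hs0.le, radialField, pucciWeight_pucciWeight_inv hα hβ,
      clampPow_eq hz.le hzD, hρeq r hr', Real.mul_rpow hs0.le hz.le, hsμ,
      show s * q r / r = (s / r) * q r by ring, pucciWeight_mul _ _ _ (by positivity)]
    field_simp
    ring

/-! ### Radial solutions in the annulus -/

section Annulus

variable {N : ℕ}

/-- Only the values of `F` at radial Hessians matter, so both Pucci operators are covered: `(α, β)`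
is `(L, l)` for the maximal one and `(l, L)` for the minimal one. -/
theorem exists_isPositiveSolution_of_pucciWeight {F : Matrix (Fin N) (Fin N) ℝ → ℝ}
    {α β a p r₁ r₂ : ℝ} (hN : 1 < N) (hα : 0 < α) (hβ : 0 < β) (hp : 1 < p) (hr₁ : 0 < r₁)
    (hr : r₁ < r₂)
    (hF : ∀ Q : Matrix (Fin N) (Fin N) ℝ, Q.IsHermitian → Q * Q = Q → ∀ k g : ℝ,
      F (k • Q + g • (1 - Q)) =
        Q.trace * pucciWeight α β k + (N - Q.trace) * pucciWeight α β g) :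
    ∃ u : EuclideanSpace ℝ (Fin N) → ℝ, IsPositiveSolution F a p (annulus N r₁ r₂) u ∧
      IsRadialOn u (closure (annulus N r₁ r₂)) := by
  have hN' : (0 : ℝ) < N - 1 := by
    rw [sub_pos]
    exact_mod_cast hN
  obtain ⟨w, w₁, w₂, hw1, hw2, hwc, hpos, hd1, hd2, hw₂c, heq⟩ :=
    exists_radial_profile (a := a) hα hβ hN' hp hr₁ hr
  refine ⟨fun x => w ‖x‖, ⟨contDiffOn_radial hr₁ hd1 hd2 hw₂c, ?_, fun x hx => ?_,
    fun x hx => hpos _ hx, fun x hx => ?_⟩, w, fun x _ => rfl⟩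
  · exact hwc.comp continuous_norm.continuousOn fun x hx => norm_mem_Icc_of_mem_closure_annulus hx
  · have hx0 : x ≠ 0 := norm_pos_iff.1 (hr₁.trans hx.1)
    have hx' : ‖x‖ ∈ Ioo r₁ r₂ := hx
    rw [hessian_radial hx0 (eventually_of_mem (Ioo_mem_nhds hx'.1 hx'.2) hd1) (hd2 _ hx'),
      hF _ (isHermitian_radialProj x) (radialProj_mul_self hx0), trace_radialProj hx0, one_mul]
    exact heq _ hx'
  · rcases norm_eq_of_mem_frontier_annulus hx with h | h <;> simp [h, hw1, hw2]

theorem hessian_neg (u : EuclideanSpace ℝ (Fin N) → ℝ) (x : EuclideanSpace ℝ (Fin N)) :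
    hessian (fun y => -u y) x = -hessian u x := by
  have h : fderiv ℝ (fun y => -u y) = fun y => -fderiv ℝ u y := funext fun y => fderiv_fun_neg
  ext i j
  simp [hessian, h, fderiv_fun_neg]

theorem IsPositiveSolution.neg {F F' : Matrix (Fin N) (Fin N) ℝ → ℝ} {a p : ℝ}
    {Ω : Set (EuclideanSpace ℝ (Fin N))} {u : EuclideanSpace ℝ (Fin N) → ℝ}
    (h : IsPositiveSolution F a p Ω u) (hF : ∀ X, F' (-X) = -F X) :
    IsNegativeSolution F' a p Ω fun x => -u x := by
  refine ⟨h.contDiffOn.neg, h.continuousOn.neg, fun x hx => ?_, fun x hx => neg_neg_of_pos (h.pos x hx),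
    fun x hx => by simp [h.boundary x hx]⟩
  have hu := h.pos x hx
  have h1 := h.equation x hx
  have h2 : u x ^ p = u x ^ (p - 1) * u x := by rw [← Real.rpow_add_one hu.ne', sub_add_cancel]
  rw [hessian_neg, hF, abs_neg, abs_of_pos hu]
  rw [h2] at h1
  linarith

theorem IsRadialOn.neg {u : EuclideanSpace ℝ (Fin N) → ℝ} {S : Set (EuclideanSpace ℝ (Fin N))}
    (h : IsRadialOn u S) : IsRadialOn (fun x => -u x) S := by
  obtain ⟨w, hw⟩ := h
  exact ⟨fun r => -w r, fun x hx => congrArg Neg.neg (hw x hx)⟩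

end Annulus

end HenonPucci

theorem theorem1 (N : ℕ) (hN : 3 ≤ N) (l L : ℝ) (hl : 0 < l) (hlL : l ≤ L)
    (p a : ℝ) (hp : 1 < p) (ha : -1 < a) (r₁ r₂ : ℝ) (hr₁ : 0 < r₁) (hr : r₁ < r₂) :
    (2 < HenonPucci.dimPlus N l L →
      ∃ u : EuclideanSpace ℝ (Fin N) → ℝ,
        HenonPucci.IsPositiveSolution (HenonPucci.pucciPlus l L) a p
          (HenonPucci.annulus N r₁ r₂) u ∧
        HenonPucci.IsRadialOn u (closure (HenonPucci.annulus N r₁ r₂))) ∧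
    (∃ u : EuclideanSpace ℝ (Fin N) → ℝ,
        HenonPucci.IsPositiveSolution (HenonPucci.pucciMinus l L) a p
          (HenonPucci.annulus N r₁ r₂) u ∧
        HenonPucci.IsRadialOn u (closure (HenonPucci.annulus N r₁ r₂))) ∧
    (2 < HenonPucci.dimPlus N l L →
      ∃ v : EuclideanSpace ℝ (Fin N) → ℝ,
        HenonPucci.IsNegativeSolution (HenonPucci.pucciMinus l L) a p
          (HenonPucci.annulus N r₁ r₂) v ∧
        HenonPucci.IsRadialOn v (closure (HenonPucci.annulus N r₁ r₂))) ∧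
    (∃ v : EuclideanSpace ℝ (Fin N) → ℝ,
        HenonPucci.IsNegativeSolution (HenonPucci.pucciPlus l L) a p
          (HenonPucci.annulus N r₁ r₂) v ∧
        HenonPucci.IsRadialOn v (closure (HenonPucci.annulus N r₁ r₂))) := by
  have hL : 0 < L := hl.trans_le hlL
  have hN1 : 1 < N := by omega
  obtain ⟨u, hu, hur⟩ := HenonPucci.exists_isPositiveSolution_of_pucciWeight (a := a) hN1 hL hl
    hp hr₁ hr fun _ hQ hQQ => HenonPucci.pucciPlus_smul_add_smul hlL hQ hQQ
  obtain ⟨v, hv, hvr⟩ := HenonPucci.exists_isPositiveSolution_of_pucciWeight (a := a) hN1 hl hL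
    hp hr₁ hr fun _ hQ hQQ => HenonPucci.pucciMinus_smul_add_smul hlL hQ hQQ
  exact ⟨fun _ => ⟨u, hu, hur⟩, ⟨v, hv, hvr⟩,
    fun _ => ⟨_, hu.neg (HenonPucci.pucciMinus_neg l L), hur.neg⟩,
    ⟨_, hv.neg (HenonPucci.pucciPlus_neg l L), hvr.neg⟩⟩
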